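/- Setting. For $k_F>0$ let $B_F=\{p\in\mathbb Z^3:|p|\le k_F\}$ and $N=|B_F|$. For $k\in\mathbb Z^3_*=\mathbb Z^3\setminus\{0\}$ let $L_k=\{p\in\mathbb Z^3: |p-k|\le k_F<|p|\}$, let $(e_p)_{p\in L_k}$ be the standard basis of $\ell^2(L_k)$, and set $\lambda_{k,p}=\frac12(|p|^2-|p-k|^2)$. Let $g>0$ and let $\hat V_k=g|k|^{-2}$ be the Coulomb potential. On $\ell^2(L_k)$ define $$h_ke_p=\lambda_{k,p}e_p,\qquad v_k=\sqrt{\frac{\hat V_k}{2(2\pi)^3}}\sum_{p\in L_k}e_p,\qquad \widetilde E_k=\Big(h_k^{1/2}\big(h_k+2|v_k\rangle\langle v_k|\big)h_k^{1/2}\Big)^{1/2}.$$ Let $c_p^*,c_p$ be the fermionic creation and annihilation operators of the plane waves $u_p(x)=(2\pi)^{-3/2}e^{ip\cdot x}$, $p\in\mathbb Z^3$, on the fermionic Fock space over $L^2([0,2\pi]^3)$ (periodic boundary conditions), and let $b_{k,p}^*=c_p^*c_{p-k}$, $b_{k,p}=c_{p-k}^*c_p$ and $b_k^*(\varphi)=\sum_{p\in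 L_k}\langle e_p,\varphi\rangle b_{k,p}^*$ for $\varphi\in\ell^2(L_k)$. Let $\psi_{FS}=\bigwedge_{p\in B_F}u_p$ be the Fermi state, let $\{\mathcal N_E=M\}$ be the space of $N$-particle states with exactly $M$ particles of momentum outside $B_F$, and let $H_{\rm kin}=\sum_{i=1}^N(-\Delta_i)$ on the $N$-particle space $\bigwedge^NL^2([0,2\pi]^3)$. The effective Hamiltonian is the operator $$H_{\rm eff}=H_{\rm kin}-\sum_{p\in B_F}|p|^2+2\sum_{l\in\mathbb Z^3_*}\ \sum_{p,q\in L_l}\big\langle e_p,(\widetilde E_l-h_l)e_q\big\rangle\, b_{l,p}^*b_{l,q}$$ on the $N$-particle space, with domain $D(H_{\rm kin})$. Theorem 1. Let $\delta\in(0,\frac12)$ and $\varepsilon\in(0,1)$. There is a constant $C>0$ depending only on $\delta$ and $\varepsilon$ such that for every $g>0$ there are $C'>0$ and $K>0$ for which the following holds for all $k_F\ge K$ and all $k\in\mathbb Z^3_*$ with $|k|\le k_F^{\delta}$. The operator $2\widetilde E_k$ has a greatest eigenvalue $\epsilon_k$, and (a) for every normalized eigenvector $\varphi_k\in\ell^2(L_k)$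 of $2\widetilde E_k$ with eigenvalue $\epsilon_k$ and every integer $M$ with $1\le M\le k_F^{\varepsilon}$, the vector $\Psi_M=b_k^*(\varphi_k)^M\psi_{FS}$ is nonzero and lies in $\{\mathcal N_E=M\}$, and the normalized state $\hat\Psi_M=\|\Psi_M\|^{-1}\Psi_M$ lies in the domain of $H_{\rm eff}$ and satisfies $$\big\|(H_{\rm eff}-M\epsilon_k)\hat\Psi_M\big\|\le C\,|k|^{-1}\sqrt{k_F}\,M^{5/2};$$ (b) $$\left|\epsilon_k-\sqrt{8\langle v_k,h_kv_k\rangle+4\,\frac{\langle v_k,h_k^3v_k\rangle}{\langle v_k,h_kv_k\rangle}}\,\right|\le C'\,k_F^{-1/2}|k|^4 .$$ -/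

import Mathlib

open scoped Classical

noncomputable section

namespace Plasmon

/-- Momenta: the lattice `ℤ³` dual to the torus `[0, 2π]³`. -/
abbrev Momentum : Type := Fin 3 → ℤ

/-- `|p|²`. -/
def normSq (p : Momentum) : ℝ := ∑ i, (p i : ℝ) ^ 2

/-- The Euclidean length `|p|`. -/
def len (p : Momentum) : ℝ := Real.sqrt (normSq p)

/-! ### Fermi ball and lunes -/

/-- The Fermi ball `B_F = {p ∈ ℤ³ : |p| ≤ k_F}` (see `mem_fermiBall`). -/
def fermiBall (kF : ℝ) : Finset Momentum :=
  (Fintype.piFinset fun _ : Fin 3 => Finset.Icc (-⌊kF⌋) ⌊kF⌋).filter fun p => len p ≤ kF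

theorem abs_le_len (p : Momentum) (i : Fin 3) : |(p i : ℝ)| ≤ len p := by
  unfold len normSq
  apply Real.abs_le_sqrt
  exact Finset.single_le_sum (f := fun j => (p j : ℝ) ^ 2) (fun j _ => sq_nonneg _)
    (Finset.mem_univ i)

theorem mem_fermiBall {kF : ℝ} {p : Momentum} : p ∈ fermiBall kF ↔ len p ≤ kF := by
  unfold fermiBall
  simp only [Finset.mem_filter, Fintype.mem_piFinset, Finset.mem_Icc, and_iff_right_iff_imp]
  intro h i
  have h1 := abs_le.mp ((abs_le_len p i).trans h)
  constructor
  · have h2 : -p i ≤ ⌊kF⌋ := Int.le_floor.mpr (by push_cast; linarith [h1.1])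
    linarith
  · exact Int.le_floor.mpr h1.2

/-- The lune `L_k = {p ∈ ℤ³ : |p - k| ≤ k_F < |p|}` (see `mem_lune`). -/
def lune (kF : ℝ) (k : Momentum) : Finset Momentum :=
  ((fermiBall kF).image fun q => q + k).filter fun p => kF < len p

theorem mem_lune {kF : ℝ} {k p : Momentum} :
    p ∈ lune kF k ↔ len (p - k) ≤ kF ∧ kF < len p := by
  unfold lune
  simp only [Finset.mem_filter, Finset.mem_image, mem_fermiBall]
  constructor
  · rintro ⟨⟨q, hq, rfl⟩, h⟩
    exact ⟨by simpa using hq, h⟩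
  · rintro ⟨h1, h2⟩
    exact ⟨⟨p - k, h1, by simp⟩, h2⟩

/-! ### One-body operators on `ℓ²(L_k)` -/

/-- The finite-dimensional Hilbert space `ℓ²(L_k)`. -/
abbrev LuneSpace (kF : ℝ) (k : Momentum) : Type := EuclideanSpace ℂ (lune kF k)

/-- The standard basis vector `e_p` of `ℓ²(L_k)`. -/
def basisVec (kF : ℝ) (k : Momentum) (p : lune kF k) : LuneSpace kF k :=
  EuclideanSpace.single p (1 : ℂ)

/-- `λ_{k,p} = (|p|² - |p - k|²) / 2`. -/
def excEnergy (k p : Momentum) : ℝ := (normSq p - normSq (p - k)) / 2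

/-- `h_k`, the diagonal operator `h_k e_p = λ_{k,p} e_p`. -/
def hOp (kF : ℝ) (k : Momentum) : LuneSpace kF k →L[ℂ] LuneSpace kF k :=
  Matrix.toEuclideanCLM (𝕜 := ℂ) (Matrix.diagonal fun p : lune kF k => (excEnergy k p : ℂ))

/-- `v_k = √(V̂_k / (2 (2π)³)) ∑_{p ∈ L_k} e_p`. -/
def vVec (kF : ℝ) (V : Momentum → ℝ) (k : Momentum) : LuneSpace kF k :=
  ((Real.sqrt (V k / (2 * (2 * Real.pi) ^ 3)) : ℝ) : ℂ) • ∑ p, basisVec kF k p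

/-- `Ẽ_k = (h_k^{1/2} (h_k + 2 |v_k⟩⟨v_k|) h_k^{1/2})^{1/2}`, with square roots of positive
operators. -/
def EOp (kF : ℝ) (V : Momentum → ℝ) (k : Momentum) : LuneSpace kF k →L[ℂ] LuneSpace kF k :=
  CFC.sqrt (CFC.sqrt (hOp kF k) *
    (hOp kF k + (2 : ℂ) • InnerProductSpace.rankOne ℂ (vVec kF V k) (vVec kF V k)) *
    CFC.sqrt (hOp kF k))

/-- The moment `⟨v_k, h_k^n v_k⟩`. -/
def vMoment (kF : ℝ) (V : Momentum → ℝ) (k : Momentum) (n : ℕ) : ℝ :=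
  (inner ℂ (vVec kF V k) ((hOp kF k ^ n) (vVec kF V k))).re

/-- The (real) eigenvalues of `2 Ẽ_k`. -/
def eigenvalues2E (kF : ℝ) (V : Momentum → ℝ) (k : Momentum) : Set ℝ :=
  {μ | Module.End.HasEigenvalue
    (((2 : ℂ) • EOp kF V k : LuneSpace kF k →L[ℂ] LuneSpace kF k) :
      Module.End ℂ (LuneSpace kF k)) (μ : ℂ)}

/-! ### Fermionic Fock space -/

/-- A set of occupied plane-wave modes `u_p(x) = (2π)^{-3/2} e^{i p·x}`. -/
abbrev Config : Type := Finset Momentum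

/-- The fermionic Fock space over `L²([0, 2π]³)` in the occupation number representation: the
basis vector at a finite set `S` is the Slater determinant of the plane waves `u_p`, `p ∈ S`
(ordered lexicographically), and a vector `Ψ` is the square summable family of its
coefficients `Ψ S` in this orthonormal basis. -/
abbrev Fock : Type := lp (fun _ : Config => ℂ) 2

/-- The sign `(-1)^{#{q ∈ S : q < p}}`, with the lexicographic order on `ℤ³`. -/
def jwSign (p : Momentum) (S : Config) : ℂ :=
  (-1) ^ (S.filter fun q => toLex q < toLex p).card

/-- The coefficients of `c_p Ψ`. -/
def annCoeff (p : Momentum) (Ψ : Config → ℂ) (S : Config) : ℂ :=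
  if p ∈ S then 0 else jwSign p S * Ψ (insert p S)

theorem norm_jwSign (p : Momentum) (S : Config) : ‖jwSign p S‖ = 1 := by
  simp [jwSign]

theorem annCoeff_sum_le (p : Momentum) (Ψ : Fock) (s : Finset Config) :
    ∑ S ∈ s, ‖annCoeff p Ψ S‖ ^ (2 : ENNReal).toReal ≤ ‖Ψ‖ ^ (2 : ENNReal).toReal := by
  have h1 : ∑ S ∈ s, ‖annCoeff p Ψ S‖ ^ (2 : ENNReal).toReal
      = ∑ S ∈ s.filter (fun S => p ∉ S), ‖Ψ (insert p S)‖ ^ (2 : ENNReal).toReal := by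
    rw [Finset.sum_filter]
    refine Finset.sum_congr rfl fun S _ => ?_
    by_cases h : p ∈ S <;> simp [annCoeff, h, norm_jwSign]
  have hinj : Set.InjOn (fun S : Config => insert p S)
      (s.filter (fun S => p ∉ S) : Finset Config) := by
    intro S hS T hT h
    simp only [Finset.coe_filter, Set.mem_ofPred_eq] at hS hT
    have h2 := congrArg (fun U : Config => U.erase p) h
    simpa [Finset.erase_insert hS.2, Finset.erase_insert hT.2] using h2
  rw [h1, ← Finset.sum_image (f := fun T : Config => ‖Ψ T‖ ^ (2 : ENNReal).toReal) hinj]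
  exact lp.sum_rpow_le_norm_rpow (by norm_num) Ψ _

/-- The annihilation operator `c_p = c(u_p)`. -/
def ann (p : Momentum) : Fock →L[ℂ] Fock :=
  LinearMap.mkContinuous
    { toFun := fun Ψ => ⟨annCoeff p Ψ, memℓp_gen' (annCoeff_sum_le p Ψ)⟩
      map_add' := fun Ψ Φ => by
        refine lp.ext (funext fun S => ?_)
        change annCoeff p (⇑Ψ + ⇑Φ) S = annCoeff p Ψ S + annCoeff p Φ S
        by_cases h : p ∈ S <;> simp [annCoeff, h, mul_add]
      map_smul' := fun a Ψ => by
        refine lp.ext (funext fun S => ?_)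
        change annCoeff p (a • ⇑Ψ) S = a * annCoeff p Ψ S
        by_cases h : p ∈ S <;> simp [annCoeff, h, mul_left_comm] }
    1 fun Ψ => by
      rw [one_mul]
      exact lp.norm_le_of_forall_sum_le (by norm_num) (norm_nonneg _) (annCoeff_sum_le p Ψ)

/-- The creation operator `c_p^* = c^*(u_p)`. -/
def cre (p : Momentum) : Fock →L[ℂ] Fock := ContinuousLinearMap.adjoint (ann p)

/-- `b_{k,p}^* = c_p^* c_{p-k}`. -/
def bCre (k p : Momentum) : Fock →L[ℂ] Fock := cre p * ann (p - k)

/-- `b_{k,p} = c_{p-k}^* c_p`. -/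
def bAnn (k p : Momentum) : Fock →L[ℂ] Fock := cre (p - k) * ann p

/-- The generalized excitation operator `b_k^*(φ) = ∑_{p ∈ L_k} ⟨e_p, φ⟩ b_{k,p}^*`. -/
def bCreGen (kF : ℝ) (k : Momentum) (φ : LuneSpace kF k) : Fock →L[ℂ] Fock :=
  ∑ p : lune kF k, inner ℂ (basisVec kF k p) φ • bCre k p

/-- The Fermi state `ψ_FS`, the Slater determinant of all plane waves in the Fermi ball. -/
def fermiState (kF : ℝ) : Fock := lp.single 2 (fermiBall kF) (1 : ℂ)

/-- The `N`-particle space `⋀^N L²([0, 2π]³)` with `N = |B_F|`. -/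
def particleSpace (kF : ℝ) : Submodule ℂ Fock where
  carrier := {Ψ | ∀ S : Config, S.card ≠ (fermiBall kF).card → Ψ S = 0}
  add_mem' := fun ha hb S hS => by simp [ha S hS, hb S hS]
  zero_mem' := fun S _ => by simp
  smul_mem' := fun c Ψ h S hS => by simp [h S hS]

/-- The subspace `{N_E = M}` of the `N`-particle space: exactly `M` particles have momenta
outside the Fermi ball. -/
def excitationSpace (kF : ℝ) (M : ℕ) : Submodule ℂ Fock where
  carrier := {Ψ | Ψ ∈ particleSpace kF ∧
    ∀ S : Config, (S \ fermiBall kF).card ≠ M → Ψ S = 0}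
  add_mem' := fun ha hb => ⟨add_mem ha.1 hb.1, fun S hS => by simp [ha.2 S hS, hb.2 S hS]⟩
  zero_mem' := ⟨zero_mem _, fun S _ => by simp⟩
  smul_mem' := fun c Ψ h => ⟨Submodule.smul_mem _ c h.1, fun S hS => by simp [h.2 S hS]⟩

/-! ### The effective Hamiltonian -/

/-- The kinetic energy `∑_{p ∈ S} |p|²` of a Slater determinant of plane waves. -/
def kinEnergy (S : Config) : ℝ := ∑ p ∈ S, normSq p

/-- The summand of momentum `l` of the interaction,
`2 ∑_{p, q ∈ L_l} ⟨e_p, (Ẽ_l - h_l) e_q⟩ b_{l,p}^* b_{l,q}`. -/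
def quasiBosonic (kF : ℝ) (V : Momentum → ℝ) (l : Momentum) : Fock →L[ℂ] Fock :=
  (2 : ℂ) • ∑ p : lune kF l, ∑ q : lune kF l,
    inner ℂ (basisVec kF l p) ((EOp kF V l - hOp kF l) (basisVec kF l q)) •
      (bCre l p * bAnn l q)

/-- The domain of `H_eff`: the vectors of the `N`-particle space in the domain of the kinetic
operator `∑_i (-Δ_i)`, on which the interaction sum over all momenta converges. -/
def effDomain (kF : ℝ) (V : Momentum → ℝ) : Submodule ℂ Fock where
  carrier := {Ψ | Ψ ∈ particleSpace kF ∧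
    Memℓp (fun S : Config => (kinEnergy S : ℂ) * Ψ S) 2 ∧
    Summable fun l : {l : Momentum // l ≠ 0} => quasiBosonic kF V l Ψ}
  add_mem' := fun {Ψ Φ} ha hb => by
    refine ⟨add_mem ha.1 hb.1, ?_, ?_⟩
    · convert ha.2.1.add hb.2.1 using 1
      ext S
      simp [mul_add]
    · simpa only [map_add] using ha.2.2.add hb.2.2
  zero_mem' := by
    refine ⟨zero_mem _, ?_, ?_⟩
    · convert (zero_memℓp : Memℓp (0 : Config → ℂ) 2) using 1
      ext S
      simp
    · simpa only [map_zero] using summable_zero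
  smul_mem' := fun c Ψ h => by
    refine ⟨Submodule.smul_mem _ c h.1, ?_, ?_⟩
    · convert h.2.1.const_smul c using 1
      ext S
      simp [mul_left_comm]
    · simpa only [map_smul] using h.2.2.const_smul c

/-- The effective Hamiltonian `H_eff = H'_kin + ∑_{l ≠ 0} quasiBosonic l`, where
`H'_kin = ∑_i (-Δ_i) - ∑_{p ∈ B_F} |p|²` is the kinetic energy relative to the Fermi state. -/
def effHamiltonian (kF : ℝ) (V : Momentum → ℝ) : Fock →ₗ.[ℂ] Fock where
  domain := effDomain kF V
  toFun :=
    { toFun := fun Ψ =>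
        ((⟨fun S => (kinEnergy S : ℂ) * (Ψ : Fock) S, Ψ.2.2.1⟩ : Fock) -
          (kinEnergy (fermiBall kF) : ℂ) • (Ψ : Fock)) +
        ∑' l : {l : Momentum // l ≠ 0}, quasiBosonic kF V l (Ψ : Fock)
      map_add' := fun Ψ Φ => by
        have h := Ψ.2.2.2.tsum_add Φ.2.2.2
        simp only [Submodule.coe_add, map_add, h]
        refine lp.ext (funext fun S => ?_)
        simp only [lp.coeFn_add, lp.coeFn_sub, lp.coeFn_smul, Pi.add_apply, Pi.sub_apply,
          Pi.smul_apply, smul_eq_mul]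
        ring
      map_smul' := fun c Ψ => by
        have h := Ψ.2.2.2.tsum_const_smul c
        simp only [Submodule.coe_smul, map_smul, h]
        refine lp.ext (funext fun S => ?_)
        simp only [lp.coeFn_add, lp.coeFn_sub, lp.coeFn_smul, Pi.add_apply, Pi.sub_apply,
          Pi.smul_apply, smul_eq_mul, RingHom.id_apply]
        ring }

/-- The Coulomb potential `V̂_k = g |k|^{-2}`. -/
def coulomb (g : ℝ) (k : Momentum) : ℝ := g / len k ^ 2

/-- The state `Ψ_M = b_k^*(φ)^M ψ_FS`. -/
def plasmonState (kF : ℝ) (k : Momentum) (φ : LuneSpace kF k) (M : ℕ) : Fock :=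
  (bCreGen kF k φ ^ M) (fermiState kF)

/-- The normalized vector `‖Ψ‖⁻¹ Ψ`. -/
def normalized (Ψ : Fock) : Fock := ((‖Ψ‖⁻¹ : ℝ) : ℂ) • Ψ

end Plasmon

end

namespace Plasmon

/-! ### Canonical anticommutation relations -/

/-! Write `x = b_k^*(φ)`. On the span of the states `x^M ψ_FS` only finitely many modes and momentum
transfers matter, so `H_eff` may be replaced there by a bounded operator
(`effHamiltonian_plasmonState`). The commutator of that operator with `x`, applied to `ψ_FS`, yields
`2 b_k^*(h_k φ)` from the kinetic energy and `2 b_k^*((Ẽ_k - h_k) φ)` from the interaction, where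
only `l = k` survives; the sum is `ε_k x ψ_FS`. The double commutator contains only creators of
particles and holes, so it commutes with `x`. Hence the error is exactly `(M choose 2) x^(M-2) Z`,
where `Z` is the double commutator applied to `ψ_FS` (`norm_effHamiltonian_sub_eq`).

The powers of `x` behave almost bosonically: `‖x^(M-2) Z‖² ≤ (M!/2) ‖Z‖²`, because `Z` has two
particles and two holes (`norm_bCreGen_pow_sq_le`), and `‖x^M ψ_FS‖² ≥ M!/2`, because the Pauli
corrections are controlled by `κ M²` with `κ = max |φ_p|²` (`norm_plasmonState_sq_ge`). The
factorials cancel, and the error of the normalized state is at most `M² ‖Z‖`.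

Two one-body facts complete (a). The operator `Ẽ_k² = h_k² + 2|w⟩⟨w|`, `w = h_k^{1/2} v_k`, is a
rank-one perturbation with `‖w‖²` of order `g k_F³`, while `h_k² ≤ (2 k_F |k|)²`. Since `δ < 1/2`,
the greatest eigenvalue lies far above the spectrum of `h_k²`, so `φ` is spread over the lune like
`w` and `|φ_p|² ≤ 128/(k_F² |k|)` (`norm_luneCoeff_sq_le`). Also `‖(Ẽ_l - h_l) e_q‖²` is of order
`λ_{l,q} g |l|^{-2}` (`norm_EOp_sub_hOp_basisVec_sq_le`). Together with `∑ |l|^{-2} = O(k_F)` over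
the transfers, `‖Z‖²` is bounded by a multiple of `g` (`norm_doubleCommutator_coulomb_sq_le`), which
for large `k_F` is below `k_F |k|^{-2}`.

For (b), the eigenvalue equation of the rank-one perturbation reduces to the secular equation `2 ∑
|w_p|² / (μ - λ_p²) = 1` with `μ = (ε_k/2)²`; expanding it to second order in `λ_p²/μ` gives the
square root (`secular_equation`, `abs_sub_le_of_secular`). -/

theorem ann_apply (p : Momentum) (Ψ : Fock) (S : Config) :
    ann p Ψ S = if p ∈ S then 0 else jwSign p S * Ψ (insert p S) := rfl

theorem Fock.neg_apply (Ψ : Fock) (S : Config) : (-Ψ) S = -Ψ S := rfl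

theorem Fock.add_apply (Ψ Φ : Fock) (S : Config) : (Ψ + Φ) S = Ψ S + Φ S := rfl

theorem Fock.sub_apply (Ψ Φ : Fock) (S : Config) : (Ψ - Φ) S = Ψ S - Φ S := rfl

theorem Fock.smul_apply (c : ℂ) (Ψ : Fock) (S : Config) : (c • Ψ) S = c * Ψ S := rfl

theorem Fock.sum_apply {ι : Type*} (s : Finset ι) (Ψ : ι → Fock) (S : Config) :
    (∑ i ∈ s, Ψ i) S = ∑ i ∈ s, Ψ i S := by
  induction s using Finset.induction_on with
  | empty => simp
  | insert a s ha ih => rw [Finset.sum_insert ha, Finset.sum_insert ha, Fock.add_apply, ih]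

theorem Fock.inner_single (S : Config) (a : ℂ) (Φ : Fock) :
    inner ℂ (lp.single 2 S a : Fock) Φ = (starRingEnd ℂ) a * Φ S :=
  (lp.inner_single_left S a Φ).trans (by simp [mul_comm])

theorem jwSign_mul_self (p : Momentum) (S : Config) : jwSign p S * jwSign p S = 1 := by
  rw [jwSign, ← pow_add, ← two_mul, pow_mul]; simp

theorem jwSign_insert {p q : Momentum} {S : Config} (h : q ∉ S) :
    jwSign p (insert q S) = (if toLex q < toLex p then -1 else 1) * jwSign p S := by
  unfold jwSign
  by_cases hqp : toLex q < toLex p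
  · rw [Finset.filter_insert, if_pos hqp, Finset.card_insert_of_notMem (by simp [h]), pow_succ]
    simp [hqp]
  · rw [Finset.filter_insert, if_neg hqp]
    simp [hqp]

theorem jwSign_insert_self (p : Momentum) (S : Config) : jwSign p (insert p S) = jwSign p S := by
  by_cases h : p ∈ S
  · rw [Finset.insert_eq_of_mem h]
  · have h1 : ¬ toLex p < toLex p := fun h => lt_irrefl (toLex p) h
    rw [jwSign_insert h, if_neg h1, one_mul]

theorem jwSign_erase_self (p : Momentum) (S : Config) : jwSign p (S.erase p) = jwSign p S := by
  rw [← jwSign_insert_self p (S.erase p)]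
  by_cases h : p ∈ S
  · rw [Finset.insert_erase h]
  · rw [Finset.erase_eq_of_notMem h, jwSign_insert_self]

theorem conj_jwSign (p : Momentum) (S : Config) : (starRingEnd ℂ) (jwSign p S) = jwSign p S := by
  simp [jwSign]

theorem ann_single (p : Momentum) (S : Config) (a : ℂ) :
    ann p (lp.single 2 S a) =
      if p ∈ S then lp.single 2 (S.erase p) (jwSign p S * a) else 0 := by
  refine lp.ext (funext fun T => ?_)
  rw [ann_apply]
  by_cases hS : p ∈ S
  · rw [if_pos hS]
    by_cases hT : p ∈ T
    · have : T ≠ S.erase p := by rintro rfl; simp at hT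
      simp [hT, lp.single_apply, this]
    · by_cases hTS : T = S.erase p
      · subst hTS
        simp [lp.single_apply, Finset.insert_erase hS, jwSign_erase_self]
      · have : insert p T ≠ S := by
          rintro rfl; exact hTS (Finset.erase_insert hT).symm
        simp [hT, lp.single_apply, hTS, this]
  · rw [if_neg hS]
    have : insert p T ≠ S := by rintro rfl; simp at hS
    simp [lp.single_apply, this]

theorem cre_apply (p : Momentum) (Ψ : Fock) (S : Config) :
    cre p Ψ S = if p ∈ S then jwSign p S * Ψ (S.erase p) else 0 := by
  have h : cre p Ψ S = inner ℂ (ann p (lp.single 2 S (1 : ℂ))) Ψ := by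
    have h1 := ContinuousLinearMap.adjoint_inner_right (ann p) (lp.single 2 S (1 : ℂ)) Ψ
    rw [← h1, Fock.inner_single]
    simp [cre]
  rw [h, ann_single]
  split_ifs with hS
  · rw [Fock.inner_single]
    simp [conj_jwSign]
  · simp

theorem lt_iff_not_lt_of_ne {p q : Momentum} (hpq : p ≠ q) :
    toLex q < toLex p ↔ ¬ toLex p < toLex q := by
  refine ⟨fun h h' => lt_asymm h h', fun h => ?_⟩
  rcases lt_trichotomy (toLex p) (toLex q) with h1 | h1 | h1
  · exact absurd h1 h
  · exact absurd (toLex.injective h1) hpq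
  · exact h1

theorem ann_mul_ann (p q : Momentum) : ann p * ann q = -(ann q * ann p) := by
  refine ContinuousLinearMap.ext fun Ψ => lp.ext (funext fun S => ?_)
  change ann p (ann q Ψ) S = -(ann q (ann p Ψ)) S
  simp only [ann_apply]
  by_cases hpq : p = q
  · subst hpq; simp
  have hqp : q ≠ p := Ne.symm hpq
  by_cases hp : p ∈ S
  · simp [hp]
  by_cases hq : q ∈ S
  · simp [hq]
  simp only [hp, hq, Finset.mem_insert, hpq, hqp, or_self, if_false, jwSign_insert hp,
    jwSign_insert hq, Finset.insert_comm q p]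
  have hlt := lt_iff_not_lt_of_ne hpq
  by_cases h : toLex p < toLex q <;> simp [h, hlt] <;> ring

theorem cre_mul_cre (p q : Momentum) : cre p * cre q = -(cre q * cre p) := by
  have h := congrArg ContinuousLinearMap.adjoint (ann_mul_ann q p)
  have e : ∀ a b : Fock →L[ℂ] Fock, ContinuousLinearMap.adjoint (a * b) =
      ContinuousLinearMap.adjoint b * ContinuousLinearMap.adjoint a := fun a b => star_mul a b
  rw [map_neg, e, e] at h
  exact h

theorem ann_mul_cre (p q : Momentum) :
    ann p * cre q = (if p = q then 1 else 0) - cre q * ann p := by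
  refine ContinuousLinearMap.ext fun Ψ => lp.ext (funext fun S => ?_)
  by_cases hpq : p = q
  · subst hpq
    change ann p (cre p Ψ) S = ((if p = p then (1 : Fock →L[ℂ] Fock) else 0) Ψ - cre p (ann p Ψ)) S
    rw [if_pos rfl, Fock.sub_apply]
    simp only [ann_apply, cre_apply, one_apply_eq_self]
    by_cases hp : p ∈ S
    · simp only [hp, if_true, Finset.notMem_erase, if_false, Finset.insert_erase hp,
        jwSign_erase_self, ← mul_assoc, jwSign_mul_self]
      simp
    · simp only [hp, if_false, Finset.mem_insert_self, if_true, jwSign_insert_self, ← mul_assoc,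
        jwSign_mul_self, Finset.erase_insert hp]
      simp
  · change ann p (cre q Ψ) S = ((if p = q then (1 : Fock →L[ℂ] Fock) else 0) Ψ - cre q (ann p Ψ)) S
    have hqp : q ≠ p := Ne.symm hpq
    rw [if_neg hpq, Fock.sub_apply]
    simp only [ann_apply, cre_apply]
    by_cases hp : p ∈ S
    · simp [hp, hpq]
    by_cases hq : q ∈ S
    · have e : insert p (S.erase q) = (insert p S).erase q := by
        rw [Finset.erase_insert_of_ne hpq]
      have h1 : jwSign p S = (if toLex q < toLex p then -1 else 1) * jwSign p (S.erase q) := by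
        conv_lhs => rw [← Finset.insert_erase hq]
        exact jwSign_insert (by simp)
      simp only [hp, hq, if_false, Finset.mem_insert, hqp, or_true, if_true, Finset.mem_erase,
        and_false, e, jwSign_insert hp, h1]
      have hlt := lt_iff_not_lt_of_ne hpq
      by_cases h : toLex p < toLex q <;> simp [h, hlt, mul_left_comm]
    · simp [hq, hqp, hp]

theorem inner_cre_left (p : Momentum) (Ψ Φ : Fock) : inner ℂ (cre p Ψ) Φ = inner ℂ Ψ (ann p Φ) :=
  ContinuousLinearMap.adjoint_inner_left _ _ _

theorem inner_cre_right (p : Momentum) (Ψ Φ : Fock) : inner ℂ Ψ (cre p Φ) = inner ℂ (ann p Ψ) Φ :=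
  ContinuousLinearMap.adjoint_inner_right _ _ _

theorem number_apply (p : Momentum) (Ψ : Fock) (S : Config) :
    (cre p * ann p) Ψ S = if p ∈ S then Ψ S else 0 := by
  change cre p (ann p Ψ) S = _
  rw [cre_apply, ann_apply]
  split_ifs with h h'
  · simp at h'
  · rw [Finset.insert_erase h, jwSign_erase_self, ← mul_assoc, jwSign_mul_self, one_mul]
  · rfl

theorem holeNumber_apply (p : Momentum) (Ψ : Fock) (S : Config) :
    (ann p * cre p) Ψ S = if p ∈ S then 0 else Ψ S := by
  rw [ann_mul_cre, if_pos rfl]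
  change (Ψ - (cre p * ann p) Ψ) S = _
  rw [Fock.sub_apply, number_apply]
  split_ifs <;> simp

/-! ### Sectors of fixed numbers of particles and holes -/

/-- The vectors with exactly `m` particles outside the set `B` and exactly `h` holes in it. -/
def sector (B : Config) (m h : ℕ) : Submodule ℂ Fock where
  carrier := {Ψ | ∀ S : Config, ¬ ((S \ B).card = m ∧ (B \ S).card = h) → Ψ S = 0}
  add_mem' := fun ha hb S hS => by simp [ha S hS, hb S hS]
  zero_mem' := fun S _ => by simp
  smul_mem' := fun c Ψ h S hS => by simp [h S hS]

variable {B : Config} {m h : ℕ} {p : Momentum} {Ψ : Fock}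

theorem cre_mem_sector (hp : p ∉ B) (hΨ : Ψ ∈ sector B m h) : cre p Ψ ∈ sector B (m + 1) h := by
  intro S hS
  rw [cre_apply]
  split_ifs with hpS
  · rw [hΨ, mul_zero]
    rintro ⟨h1, h2⟩
    refine hS ⟨?_, ?_⟩
    · rw [← h1, Finset.erase_sdiff_comm, Finset.card_erase_add_one (by simp [hp, hpS])]
    · rw [← h2]
      congr 1
      ext x
      simp only [Finset.mem_sdiff, Finset.mem_erase]
      constructor
      · rintro ⟨h3, h4⟩; exact ⟨h3, fun h5 => h4 h5.2⟩
      · rintro ⟨h3, h4⟩; exact ⟨h3, fun h5 => h4 ⟨fun h6 => hp (h6 ▸ h3), h5⟩⟩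
  · rfl

theorem ann_mem_sector (hp : p ∈ B) (hΨ : Ψ ∈ sector B m h) : ann p Ψ ∈ sector B m (h + 1) := by
  intro S hS
  rw [ann_apply]
  split_ifs with hpS
  · rfl
  · rw [hΨ, mul_zero]
    rintro ⟨h1, h2⟩
    refine hS ⟨?_, ?_⟩
    · rw [← h1, Finset.insert_sdiff_of_mem _ hp]
    · rw [← h2, ← Finset.card_erase_add_one (s := B \ S) (a := p) (by simp [hp, hpS])]
      congr 2
      ext x
      simp only [Finset.mem_sdiff, Finset.mem_erase, Finset.mem_insert]
      tauto

theorem cre_hole_mem_sector (hp : p ∈ B) (hΨ : Ψ ∈ sector B m (h + 1)) :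
    cre p Ψ ∈ sector B m h := by
  intro S hS
  rw [cre_apply]
  split_ifs with hpS
  · rw [hΨ, mul_zero]
    rintro ⟨h1, h2⟩
    refine hS ⟨?_, ?_⟩
    · rw [← h1]
      congr 1
      ext x
      simp only [Finset.mem_sdiff, Finset.mem_erase]
      constructor
      · rintro ⟨h3, h4⟩; exact ⟨⟨fun h6 => h4 (h6 ▸ hp), h3⟩, h4⟩
      · rintro ⟨h3, h4⟩; exact ⟨h3.2, h4⟩
    · have : B \ S.erase p = insert p (B \ S) := by
        ext x
        simp only [Finset.mem_sdiff, Finset.mem_erase, Finset.mem_insert]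
        by_cases hx : x = p
        · subst hx; simp [hp]
        · simp [hx]
      rw [this, Finset.card_insert_of_notMem (by simp [hpS])] at h2
      omega
  · rfl

/-- Intended for occupation counts, which act diagonally on Slater determinants. -/
theorem norm_le_of_apply_eq {Φ Ψ : Fock} {c : Config → ℕ} {n : ℕ}
    (h : ∀ S, Φ S = (c S : ℂ) * Ψ S) (hc : ∀ S, Ψ S ≠ 0 → c S ≤ n) : ‖Φ‖ ≤ n * ‖Ψ‖ := by
  have h1 : ‖Φ‖ ≤ ‖((n : ℂ) • Ψ : Fock)‖ := by
    refine lp.norm_mono (by norm_num) fun S => ?_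
    rw [h, Fock.smul_apply, norm_mul, norm_mul]
    by_cases hS : Ψ S = 0
    · simp [hS]
    · gcongr
      simpa using hc S hS
  simpa [norm_smul] using h1

/-- The sum of the `c_p^* c_p` counts the occupied modes of `s`; as `s` avoids `B`, each
configuration in the sector has at most `m` of them. -/
theorem sum_norm_ann_sq_le {s : Finset Momentum} (hs : ∀ p ∈ s, p ∉ B)
    (hΨ : Ψ ∈ sector B m h) : ∑ p ∈ s, ‖ann p Ψ‖ ^ 2 ≤ m * ‖Ψ‖ ^ 2 := by
  have h1 : ∑ p ∈ s, ‖ann p Ψ‖ ^ 2 = (inner ℂ Ψ (∑ p ∈ s, (cre p * ann p) Ψ)).re := by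
    rw [inner_sum, Complex.re_sum]
    refine Finset.sum_congr rfl fun p _ => ?_
    change _ = (inner ℂ Ψ (cre p (ann p Ψ))).re
    rw [inner_cre_right]
    exact norm_sq_eq_re_inner (𝕜 := ℂ) _
  have h2 : ‖∑ p ∈ s, (cre p * ann p) Ψ‖ ≤ m * ‖Ψ‖ := by
    refine norm_le_of_apply_eq (c := fun S => (s ∩ S).card) (fun S => ?_) fun S hS => ?_
    · rw [Fock.sum_apply]
      simp only [number_apply]
      rw [Finset.sum_ite_mem, Finset.sum_const, nsmul_eq_mul]
    · by_contra hlt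
      refine hS (hΨ S fun hcard => hlt ?_)
      rw [← hcard.1]
      refine Finset.card_le_card fun x hx => ?_
      simp only [Finset.mem_inter] at hx
      simp [hx.2, hs x hx.1]
  rw [h1]
  refine (Complex.re_le_norm _).trans ((norm_inner_le_norm _ _).trans ?_)
  nlinarith [norm_nonneg Ψ]

theorem sum_norm_cre_sq_le {s : Finset Momentum} (hs : ∀ p ∈ s, p ∈ B)
    (hΨ : Ψ ∈ sector B m h) : ∑ p ∈ s, ‖cre p Ψ‖ ^ 2 ≤ h * ‖Ψ‖ ^ 2 := by
  have h1 : ∑ p ∈ s, ‖cre p Ψ‖ ^ 2 = (inner ℂ Ψ (∑ p ∈ s, (ann p * cre p) Ψ)).re := by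
    rw [inner_sum, Complex.re_sum]
    refine Finset.sum_congr rfl fun p _ => ?_
    change _ = (inner ℂ Ψ (ann p (cre p Ψ))).re
    rw [← inner_cre_left]
    exact norm_sq_eq_re_inner (𝕜 := ℂ) _
  have h2 : ‖∑ p ∈ s, (ann p * cre p) Ψ‖ ≤ h * ‖Ψ‖ := by
    refine norm_le_of_apply_eq (c := fun S => (s \ S).card) (fun S => ?_) fun S hS => ?_
    · rw [Fock.sum_apply]
      simp only [holeNumber_apply]
      rw [Finset.sum_ite, Finset.sum_const_zero, zero_add, Finset.sum_const, nsmul_eq_mul,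
        Finset.sdiff_eq_filter]
    · by_contra hlt
      refine hS (hΨ S fun hcard => hlt ?_)
      rw [← hcard.2]
      refine Finset.card_le_card fun x hx => ?_
      simp only [Finset.mem_sdiff] at hx
      simp [hx.2, hs x hx.1]
  rw [h1]
  refine (Complex.re_le_norm _).trans ((norm_inner_le_norm _ _).trans ?_)
  nlinarith [norm_nonneg Ψ]

theorem sector_le_excitationSpace (kF : ℝ) (n : ℕ) :
    sector (fermiBall kF) n n ≤ excitationSpace kF n := by
  intro Ψ hΨ
  refine ⟨fun S hS => hΨ S fun hc => hS ?_, fun S hS => hΨ S fun hc => hS hc.1⟩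
  have h1 := Finset.card_sdiff_add_card_inter S (fermiBall kF)
  have h2 := Finset.card_sdiff_add_card_inter (fermiBall kF) S
  rw [Finset.inter_comm] at h2
  omega

theorem fermiState_mem_sector (kF : ℝ) : fermiState kF ∈ sector (fermiBall kF) 0 0 := by
  intro S hS
  rw [fermiState, lp.single_apply, Pi.single_apply, if_neg]
  rintro rfl
  simp at hS

theorem norm_fermiState (kF : ℝ) : ‖fermiState kF‖ = 1 := by
  rw [fermiState, lp.norm_single (by norm_num)]; simp

theorem ann_fermiState {kF : ℝ} (hp : p ∉ fermiBall kF) : ann p (fermiState kF) = 0 := by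
  rw [fermiState, ann_single, if_neg hp]

theorem cre_fermiState {kF : ℝ} (hp : p ∈ fermiBall kF) : cre p (fermiState kF) = 0 := by
  refine lp.ext (funext fun S => ?_)
  rw [cre_apply]
  split_ifs with hS
  · rw [fermiState, lp.single_apply, Pi.single_apply, if_neg]
    · simp
    · intro h; rw [← h] at hp; simp at hp
  · rfl

end Plasmon

namespace Plasmon

/-! ### Commutators with the generalized excitation operators -/

/-- The coefficients of `φ ∈ ℓ²(L_k)`, extended by zero to all momenta. -/
noncomputable def luneCoeff {kF : ℝ} {k : Momentum} (φ : LuneSpace kF k) (p : Momentum) : ℂ :=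
  if h : p ∈ lune kF k then φ ⟨p, h⟩ else 0

section Lune

variable {kF : ℝ} {k l p q a : Momentum} (φ ψ : LuneSpace kF k)

theorem luneCoeff_of_notMem (h : p ∉ lune kF k) : luneCoeff φ p = 0 := dif_neg h

theorem luneCoeff_coe (p : lune kF k) : luneCoeff φ p = φ p := dif_pos p.2

theorem luneCoeff_smul (c : ℂ) (p : Momentum) : luneCoeff (c • φ) p = c * luneCoeff φ p := by
  unfold luneCoeff
  split_ifs <;> simp

theorem luneCoeff_add (p : Momentum) : luneCoeff (φ + ψ) p = luneCoeff φ p + luneCoeff ψ p := by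
  unfold luneCoeff
  split_ifs <;> simp

theorem notMem_fermiBall_of_mem_lune (h : p ∈ lune kF k) : p ∉ fermiBall kF := by
  rw [mem_fermiBall, not_le]; exact (mem_lune.mp h).2

theorem sub_mem_fermiBall_of_mem_lune (h : p ∈ lune kF k) : p - k ∈ fermiBall kF :=
  mem_fermiBall.mpr (mem_lune.mp h).1

theorem mem_lune_iff : p ∈ lune kF k ↔ p - k ∈ fermiBall kF ∧ p ∉ fermiBall kF := by
  rw [mem_lune, mem_fermiBall, mem_fermiBall, not_le]

theorem luneCoeff_of_mem_fermiBall (h : p ∈ fermiBall kF) : luneCoeff φ p = 0 :=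
  luneCoeff_of_notMem φ fun h' => notMem_fermiBall_of_mem_lune h' h

theorem luneCoeff_add_of_notMem_fermiBall (h : p ∉ fermiBall kF) : luneCoeff φ (p + k) = 0 :=
  luneCoeff_of_notMem φ fun h' => h (by simpa using sub_mem_fermiBall_of_mem_lune h')

theorem bCreGen_eq : bCreGen kF k φ =
    ∑ p ∈ lune kF k, luneCoeff φ p • (cre p * ann (p - k)) := by
  rw [bCreGen, ← Finset.sum_coe_sort (lune kF k)]
  refine Finset.sum_congr rfl fun p _ => ?_
  rw [luneCoeff_coe, basisVec, EuclideanSpace.inner_single_left]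
  simp [bCre]

theorem bCreGen_smul (c : ℂ) : bCreGen kF k (c • φ) = c • bCreGen kF k φ := by
  simp only [bCreGen_eq, luneCoeff_smul, Finset.smul_sum, smul_smul]

theorem bCreGen_add : bCreGen kF k (φ + ψ) = bCreGen kF k φ + bCreGen kF k ψ := by
  simp only [bCreGen_eq, luneCoeff_add, add_smul, Finset.sum_add_distrib]

theorem bCreGen_zero : bCreGen kF k 0 = 0 := by
  have := bCreGen_smul (0 : LuneSpace kF k) 0
  simpa using this

theorem bCreGen_sum {ι : Type*} (s : Finset ι) (Φ : ι → LuneSpace kF k) :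
    bCreGen kF k (∑ i ∈ s, Φ i) = ∑ i ∈ s, bCreGen kF k (Φ i) := by
  induction s using Finset.induction_on with
  | empty => simp [bCreGen_zero]
  | insert a s ha ih => rw [Finset.sum_insert ha, Finset.sum_insert ha, bCreGen_add, ih]

theorem ann_mul_bCreGen (q : Momentum) : ann q * bCreGen kF k φ =
    bCreGen kF k φ * ann q + luneCoeff φ q • ann (q - k) := by
  have h1 : ∀ p, ann q * (luneCoeff φ p • (cre p * ann (p - k))) =
      luneCoeff φ p • (cre p * ann (p - k)) * ann q +
        if q = p then luneCoeff φ p • ann (p - k) else 0 := fun p => by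
    have h2 : ann q * (cre p * ann (p - k)) =
        cre p * ann (p - k) * ann q + if q = p then ann (p - k) else 0 := by
      rw [← mul_assoc, ann_mul_cre, sub_mul, mul_assoc (cre p), ann_mul_ann q, mul_neg,
        sub_neg_eq_add, ← mul_assoc, add_comm]
      split_ifs <;> simp
    rw [mul_smul_comm, h2, smul_add, smul_mul_assoc, smul_ite, smul_zero]
  rw [bCreGen_eq, Finset.mul_sum, Finset.sum_congr rfl fun p _ => h1 p, Finset.sum_add_distrib,
    Finset.sum_mul, Finset.sum_ite_eq]
  congr 1
  split_ifs with h
  · rfl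
  · rw [luneCoeff_of_notMem φ h, zero_smul]

theorem cre_mul_bCreGen (a : Momentum) : cre a * bCreGen kF k φ =
    bCreGen kF k φ * cre a + (-luneCoeff φ (a + k)) • cre (a + k) := by
  have h1 : ∀ p, cre a * (luneCoeff φ p • (cre p * ann (p - k))) =
      luneCoeff φ p • (cre p * ann (p - k)) * cre a +
        if a + k = p then (-luneCoeff φ p) • cre p else 0 := fun p => by
    have h2 : cre a * (cre p * ann (p - k)) =
        cre p * ann (p - k) * cre a + if a + k = p then -cre p else 0 := by
      rw [← mul_assoc, cre_mul_cre a, mul_assoc (cre p), ann_mul_cre, mul_sub, neg_mul, mul_assoc,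
        sub_add_eq_add_sub]
      by_cases h : a + k = p
      · simp [← h]
      · have h' : ¬ p - k = a := fun h'' => h (by rw [← h'']; simp)
        simp [h, h']
    rw [mul_smul_comm, h2, smul_add, smul_mul_assoc]
    split_ifs <;> simp
  rw [bCreGen_eq, Finset.mul_sum, Finset.sum_congr rfl fun p _ => h1 p, Finset.sum_add_distrib,
    Finset.sum_mul, Finset.sum_ite_eq]
  congr 1
  split_ifs with h
  · rfl
  · rw [luneCoeff_of_notMem φ h, neg_zero, zero_smul]

theorem ann_mul_bCreGen_of_mem (h : a ∈ fermiBall kF) :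
    ann a * bCreGen kF k φ = bCreGen kF k φ * ann a := by
  rw [ann_mul_bCreGen, luneCoeff_of_mem_fermiBall φ h, zero_smul, add_zero]

theorem cre_mul_bCreGen_of_notMem (h : p ∉ fermiBall kF) :
    cre p * bCreGen kF k φ = bCreGen kF k φ * cre p := by
  rw [cre_mul_bCreGen, luneCoeff_add_of_notMem_fermiBall φ h, neg_zero, zero_smul, add_zero]

/-- A pair `c_r^* c_{r-k}` in `b_k^*(φ)` has `r` outside and `r - k` inside the ball, so neither
`c_p^*` nor `c_a` finds a partner with which its anticommutator is nonzero. -/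
theorem cre_mul_ann_mul_bCreGen (hp : p ∉ fermiBall kF) (ha : a ∈ fermiBall kF) :
    cre p * ann a * bCreGen kF k φ = bCreGen kF k φ * (cre p * ann a) := by
  rw [mul_assoc, ann_mul_bCreGen_of_mem φ ha, ← mul_assoc, cre_mul_bCreGen_of_notMem φ hp,
    mul_assoc]

theorem bCreGen_mul_bCreGen (χ : LuneSpace kF l) :
    bCreGen kF l χ * bCreGen kF k φ = bCreGen kF k φ * bCreGen kF l χ := by
  rw [bCreGen_eq χ, Finset.sum_mul, Finset.mul_sum]
  refine Finset.sum_congr rfl fun p hp => ?_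
  rw [smul_mul_assoc, cre_mul_ann_mul_bCreGen φ (notMem_fermiBall_of_mem_lune hp)
    (sub_mem_fermiBall_of_mem_lune hp), mul_smul_comm]

theorem bAnn_mul_bCreGen (l q : Momentum) : bAnn l q * bCreGen kF k φ =
    bCreGen kF k φ * bAnn l q +
      ((-luneCoeff φ (q - l + k)) • (cre (q - l + k) * ann q) +
        luneCoeff φ q • (cre (q - l) * ann (q - k))) := by
  rw [bAnn, mul_assoc, ann_mul_bCreGen, mul_add, ← mul_assoc, cre_mul_bCreGen, add_mul,
    mul_smul_comm, smul_mul_assoc, mul_assoc, add_assoc]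

/-- The weight `luneCoeff φ r` is kept in front because it forces `r` into the lune; then `c_r^*`
passes through and only `c_q` contributes. -/
theorem smul_cre_ann_mul_bCreGen (q r : Momentum) :
    (luneCoeff φ r • (cre r * ann q)) * bCreGen kF k φ =
      bCreGen kF k φ * (luneCoeff φ r • (cre r * ann q)) +
        (luneCoeff φ r * luneCoeff φ q) • (cre r * ann (q - k)) := by
  by_cases h : r ∈ lune kF k
  · rw [smul_mul_assoc, mul_assoc, ann_mul_bCreGen, mul_add, ← mul_assoc,
      cre_mul_bCreGen_of_notMem φ (notMem_fermiBall_of_mem_lune h), smul_add, mul_smul_comm,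
      mul_smul_comm, smul_smul, mul_assoc]
  · simp [luneCoeff_of_notMem φ h]

theorem smul_cre_hole_ann_mul_bCreGen (q a : Momentum) :
    (luneCoeff φ q • (cre a * ann (q - k))) * bCreGen kF k φ =
      bCreGen kF k φ * (luneCoeff φ q • (cre a * ann (q - k))) +
        (-(luneCoeff φ q * luneCoeff φ (a + k))) • (cre (a + k) * ann (q - k)) := by
  by_cases h : q ∈ lune kF k
  · rw [smul_mul_assoc, mul_assoc, ann_mul_bCreGen_of_mem φ (sub_mem_fermiBall_of_mem_lune h),
      ← mul_assoc, cre_mul_bCreGen, add_mul, smul_add, mul_smul_comm, smul_mul_assoc, smul_smul,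
      mul_assoc, mul_neg]
  · simp [luneCoeff_of_notMem φ h]

/-- The first commutator `[b_{l,q}, b_k^*(φ)]`. -/
noncomputable def exchange (l q : Momentum) : Fock →L[ℂ] Fock :=
  (-luneCoeff φ (q - l + k)) • (cre (q - l + k) * ann q) +
    luneCoeff φ q • (cre (q - l) * ann (q - k))

/-- The second commutator `[[b_{l,q}, b_k^*(φ)], b_k^*(φ)]`. -/
noncomputable def doubleExchange (l q : Momentum) : Fock →L[ℂ] Fock :=
  (-2 * (luneCoeff φ q * luneCoeff φ (q - l + k))) • (cre (q - l + k) * ann (q - k))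

theorem exchange_mul_bCreGen (l q : Momentum) : exchange φ l q * bCreGen kF k φ =
    bCreGen kF k φ * exchange φ l q + doubleExchange φ l q := by
  rw [exchange, add_mul, neg_smul, neg_mul, smul_cre_ann_mul_bCreGen,
    smul_cre_hole_ann_mul_bCreGen, doubleExchange, mul_add, mul_neg]
  module

theorem doubleExchange_mul_bCreGen (l q : Momentum) : doubleExchange φ l q * bCreGen kF k φ =
    bCreGen kF k φ * doubleExchange φ l q := by
  rw [doubleExchange]
  by_cases hq : q ∈ lune kF k
  · by_cases hr : q - l + k ∈ lune kF k
    · rw [smul_mul_assoc, cre_mul_ann_mul_bCreGen φ (notMem_fermiBall_of_mem_lune hr)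
        (sub_mem_fermiBall_of_mem_lune hq), mul_smul_comm]
    · simp [luneCoeff_of_notMem φ hr]
  · simp [luneCoeff_of_notMem φ hq]

/-- The expansion stops after the double commutator because `c` commutes with `x`. The truncated
exponents for small `n` are harmless: the corresponding coefficients `n` or `n.choose 2` are zero.
-/
theorem mul_pow_of_commutators {R : Type*} [Ring R] {x a b c : R} (h1 : a * x = x * a + b)
    (h2 : b * x = x * b + c) (h3 : c * x = x * c) (n : ℕ) :
    a * x ^ n = x ^ n * a + n • (x ^ (n - 1) * b) + n.choose 2 • (x ^ (n - 2) * c) := by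
  induction n with
  | zero => simp
  | succ n ih =>
    have e1 : n • (x ^ (n - 1) * x) = n • x ^ n := by
      rcases n with _ | n
      · simp
      · rw [← pow_succ]; rfl
    have e2 : n.choose 2 • (x ^ (n - 2) * x) = n.choose 2 • x ^ (n - 1) := by
      rcases n with _ | _ | n
      · simp
      · simp
      · rw [← pow_succ]; rfl
    have e3 : (n + 1).choose 2 = n + n.choose 2 := by
      rw [Nat.choose_succ_succ' n 1, Nat.choose_one_right]
    have e4 : n + 1 - 2 = n - 1 := by omega
    have e5 : n • (x ^ (n - 1) * b) * x = n • (x ^ n * b) + n • (x ^ (n - 1) * c) := by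
      rw [smul_mul_assoc, mul_assoc, h2, mul_add, smul_add, ← mul_assoc,
        ← smul_mul_assoc n (x ^ (n - 1) * x), e1, smul_mul_assoc]
    have e6 : n.choose 2 • (x ^ (n - 2) * c) * x = n.choose 2 • (x ^ (n - 1) * c) := by
      rw [smul_mul_assoc, mul_assoc, h3, ← mul_assoc, ← smul_mul_assoc, e2, smul_mul_assoc]
    rw [pow_succ, ← mul_assoc, ih, add_mul, add_mul, e5, e6, mul_assoc, h1, mul_add, ← mul_assoc,
      e3, e4, add_smul, Nat.add_sub_cancel, add_smul, one_smul]
    abel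

/-! ### The interaction terms -/

variable (V : Momentum → ℝ)

/-- The creation operator `b_l^*((Ẽ_l - h_l) e_q)`. -/
noncomputable def dressedCre (kF : ℝ) (l : Momentum) (q : lune kF l) : Fock →L[ℂ] Fock :=
  bCreGen kF l ((EOp kF V l - hOp kF l) (basisVec kF l q))

theorem quasiBosonic_eq (l : Momentum) : quasiBosonic kF V l =
    (2 : ℂ) • ∑ q : lune kF l, dressedCre V kF l q * bAnn l q := by
  rw [quasiBosonic, Finset.sum_comm]
  refine congrArg (fun x => (2 : ℂ) • x) (Finset.sum_congr rfl fun q _ => ?_)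
  rw [dressedCre, bCreGen, Finset.sum_mul]
  exact Finset.sum_congr rfl fun p _ => (smul_mul_assoc _ _ _).symm

/-- The dressed creators commute with `b_k^*(φ)`, so only the annihilating factor contributes to the
commutator. -/
theorem quasiBosonic_mul_bCreGen (l : Momentum) : quasiBosonic kF V l * bCreGen kF k φ =
    bCreGen kF k φ * quasiBosonic kF V l +
      (2 : ℂ) • ∑ q : lune kF l, dressedCre V kF l q * exchange φ l q := by
  rw [quasiBosonic_eq, smul_mul_assoc, mul_smul_comm, ← smul_add, Finset.sum_mul, Finset.mul_sum,
    ← Finset.sum_add_distrib]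
  refine congrArg (fun x => (2 : ℂ) • x) (Finset.sum_congr rfl fun q _ => ?_)
  rw [mul_assoc, bAnn_mul_bCreGen, mul_add, ← mul_assoc, dressedCre, bCreGen_mul_bCreGen,
    mul_assoc, exchange]

theorem sum_dressed_exchange_mul_bCreGen (l : Momentum) :
    ((2 : ℂ) • ∑ q : lune kF l, dressedCre V kF l q * exchange φ l q) * bCreGen kF k φ =
    bCreGen kF k φ * ((2 : ℂ) • ∑ q : lune kF l, dressedCre V kF l q * exchange φ l q) +
      (2 : ℂ) • ∑ q : lune kF l, dressedCre V kF l q * doubleExchange φ l q := by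
  rw [smul_mul_assoc, mul_smul_comm, ← smul_add, Finset.sum_mul, Finset.mul_sum,
    ← Finset.sum_add_distrib]
  refine congrArg (fun x => (2 : ℂ) • x) (Finset.sum_congr rfl fun q _ => ?_)
  rw [mul_assoc, exchange_mul_bCreGen, mul_add, ← mul_assoc, dressedCre, bCreGen_mul_bCreGen,
    mul_assoc]

theorem sum_dressed_doubleExchange_mul_bCreGen (l : Momentum) :
    ((2 : ℂ) • ∑ q : lune kF l, dressedCre V kF l q * doubleExchange φ l q) * bCreGen kF k φ =
    bCreGen kF k φ *
      ((2 : ℂ) • ∑ q : lune kF l, dressedCre V kF l q * doubleExchange φ l q) := by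
  rw [smul_mul_assoc, mul_smul_comm, Finset.sum_mul, Finset.mul_sum]
  refine congrArg (fun x => (2 : ℂ) • x) (Finset.sum_congr rfl fun q _ => ?_)
  rw [mul_assoc, doubleExchange_mul_bCreGen, ← mul_assoc, dressedCre, bCreGen_mul_bCreGen,
    mul_assoc]

/-! ### The kinetic energy -/

/-- The kinetic energy of the modes in the finite set `s`. -/
noncomputable def kinOp (s : Finset Momentum) : Fock →L[ℂ] Fock :=
  ∑ p ∈ s, (normSq p : ℂ) • (cre p * ann p)

theorem kinOp_mul_cre {s : Finset Momentum} (hq : q ∈ s) :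
    kinOp s * cre q = cre q * kinOp s + (normSq q : ℂ) • cre q := by
  have h1 : ∀ p, cre p * ann p * cre q = cre q * (cre p * ann p) + if p = q then cre p else 0 :=
    fun p => by
      rw [mul_assoc, ann_mul_cre, mul_sub, ← mul_assoc, cre_mul_cre p q, neg_mul, sub_neg_eq_add,
        add_comm, mul_assoc]
      split_ifs <;> simp
  rw [kinOp, Finset.sum_mul, Finset.mul_sum]
  simp only [smul_mul_assoc, h1, smul_add, mul_smul_comm, Finset.sum_add_distrib, smul_ite,
    smul_zero, Finset.sum_ite_eq', hq, if_true]

theorem kinOp_mul_ann {s : Finset Momentum} (ha : a ∈ s) :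
    kinOp s * ann a = ann a * kinOp s + (-(normSq a : ℂ)) • ann a := by
  have h1 : ∀ p, cre p * ann p * ann a = ann a * (cre p * ann p) + if p = a then -ann p else 0 :=
    fun p => by
      rw [mul_assoc, ann_mul_ann, mul_neg, ← mul_assoc, ← mul_assoc, ann_mul_cre, sub_mul, eq_comm]
      by_cases h : p = a
      · subst h; simp; abel
      · have h' : ¬ a = p := fun h'' => h h''.symm
        simp [h, h']
  rw [kinOp, Finset.sum_mul, Finset.mul_sum]
  simp only [smul_mul_assoc, h1, smul_add, mul_smul_comm, Finset.sum_add_distrib, smul_ite,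
    smul_zero, Finset.sum_ite_eq', ha, if_true, smul_neg, neg_smul]

theorem hOp_apply (p : lune kF k) : hOp kF k φ p = (excEnergy k p : ℂ) * φ p := by
  rw [hOp]
  simp [Matrix.mulVec_diagonal]

/-- Each pair raises the kinetic energy by `|p|² - |p-k|² = 2 λ_{k,p}`; hence the factor `2`. -/
theorem kinOp_mul_bCreGen {s : Finset Momentum} (h1 : lune kF k ⊆ s) (h2 : fermiBall kF ⊆ s) :
    kinOp s * bCreGen kF k φ =
      bCreGen kF k φ * kinOp s + (2 : ℂ) • bCreGen kF k (hOp kF k φ) := by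
  rw [bCreGen_eq φ, bCreGen_eq (hOp kF k φ), Finset.mul_sum, Finset.sum_mul, Finset.smul_sum,
    ← Finset.sum_add_distrib]
  refine Finset.sum_congr rfl fun p hp => ?_
  have e : luneCoeff (hOp kF k φ) p = (excEnergy k p : ℂ) * luneCoeff φ p := by
    unfold luneCoeff
    rw [dif_pos hp, dif_pos hp, hOp_apply]
  rw [e, mul_smul_comm, ← mul_assoc, kinOp_mul_cre (h1 hp), add_mul, mul_assoc,
    kinOp_mul_ann (h2 (sub_mem_fermiBall_of_mem_lune hp)), mul_add, ← mul_assoc, excEnergy,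
    smul_mul_assoc, mul_smul_comm, smul_mul_assoc]
  push_cast
  module

theorem kinOp_apply (s : Finset Momentum) (Ψ : Fock) (S : Config) :
    kinOp s Ψ S = (∑ p ∈ s ∩ S, normSq p : ℝ) * Ψ S := by
  have : kinOp s Ψ = ∑ p ∈ s, (normSq p : ℂ) • (cre p * ann p) Ψ := by
    rw [kinOp, sum_apply]
    rfl
  rw [this, Fock.sum_apply]
  simp only [Fock.smul_apply, number_apply, mul_ite, mul_zero]
  rw [Finset.sum_ite_mem, Complex.ofReal_sum, Finset.sum_mul]

/-- A configuration with nonzero coefficient cannot occupy a mode outside `s`, so the bounded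
truncation agrees with the unbounded kinetic energy on such states. -/
theorem kinOp_apply_of_ann_eq_zero {s : Finset Momentum} {Ψ : Fock}
    (h : ∀ q ∉ s, ann q Ψ = 0) (S : Config) : kinOp s Ψ S = kinEnergy S * Ψ S := by
  rw [kinOp_apply]
  by_cases hS : S ⊆ s
  · rw [Finset.inter_eq_right.mpr hS, kinEnergy]
  · obtain ⟨q, hq, hqs⟩ := Finset.not_subset.mp hS
    have h1 : ann q Ψ (S.erase q) = 0 := by rw [h q hqs]; rfl
    rw [ann_apply, if_neg (by simp), Finset.insert_erase hq] at h1
    have h2 : jwSign q (S.erase q) ≠ 0 := by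
      rw [← norm_ne_zero_iff, norm_jwSign]; exact one_ne_zero
    rw [(mul_eq_zero.mp h1).resolve_left h2]
    simp

end Lune

end Plasmon

namespace Plasmon

/-! ### The effective Hamiltonian on the plasmon states -/

section PlasmonStates

variable {kF : ℝ} {k l p q a : Momentum} (φ : LuneSpace kF k) (V : Momentum → ℝ)

/-! ### First-order action on the Fermi state -/

theorem quasiBosonic_fermiState (l : Momentum) : quasiBosonic kF V l (fermiState kF) = 0 := by
  rw [quasiBosonic_eq, smul_apply, sum_apply, Finset.sum_eq_zero, smul_zero]
  intro q _
  change dressedCre V kF l q (cre (q - l) (ann q (fermiState kF))) = 0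
  rw [ann_fermiState (notMem_fermiBall_of_mem_lune q.2), map_zero, map_zero]

theorem cre_ann_fermiState {a b : Momentum} (ha : a ∈ fermiBall kF) :
    cre a (ann b (fermiState kF)) = if b = a then fermiState kF else 0 := by
  have h := congrArg (fun T : Fock →L[ℂ] Fock => T (fermiState kF)) (ann_mul_cre b a)
  change ann b (cre a (fermiState kF)) = (if b = a then (1 : Fock →L[ℂ] Fock) else 0) (fermiState kF)
    - cre a (ann b (fermiState kF)) at h
  rw [cre_fermiState ha, map_zero, eq_comm, sub_eq_zero] at h
  rw [← h]
  split_ifs <;> rfl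

theorem exchange_fermiState (q : lune kF l) :
    exchange φ l q (fermiState kF) = if l = k then luneCoeff φ q • fermiState kF else 0 := by
  change (-luneCoeff φ (q - l + k)) • cre (q - l + k) (ann q (fermiState kF)) +
    luneCoeff φ q • cre (q - l) (ann (q - k) (fermiState kF)) = _
  rw [ann_fermiState (notMem_fermiBall_of_mem_lune q.2), map_zero, smul_zero, zero_add,
    cre_ann_fermiState (sub_mem_fermiBall_of_mem_lune q.2), smul_ite, smul_zero]
  by_cases h : l = k
  · simp [h]
  · rw [if_neg h, if_neg]
    intro h'
    exact h (sub_right_injective h').symm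

theorem sum_basisVec : ∑ q, φ q • basisVec kF k q = φ := by
  convert (EuclideanSpace.basisFun (lune kF k) ℂ).sum_repr φ using 3 <;> simp [basisVec]

/-- In the Fermi state `c_{q-l}^* c_{q-k}` has no effect unless it refills the hole it makes, which
requires `l = k`. The coefficients of `φ` then reassemble the vector by linearity. -/
theorem sum_dressed_exchange_fermiState (l : Momentum) :
    ((2 : ℂ) • ∑ q : lune kF l, dressedCre V kF l q * exchange φ l q) (fermiState kF) =
      if l = k then (2 : ℂ) • bCreGen kF k ((EOp kF V k - hOp kF k) φ) (fermiState kF) else 0 := by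
  rw [smul_apply, sum_apply]
  have h1 : ∀ q : lune kF l, (dressedCre V kF l q * exchange φ l q) (fermiState kF) =
      dressedCre V kF l q (if l = k then luneCoeff φ q • fermiState kF else 0) := fun q => by
    change dressedCre V kF l q (exchange φ l q (fermiState kF)) = _
    rw [exchange_fermiState]
  rw [Finset.sum_congr rfl fun q _ => h1 q]
  by_cases h : l = k
  · subst h
    simp only [if_true]
    congr 1
    conv_rhs => rw [← sum_basisVec φ]
    rw [map_sum, bCreGen_sum, sum_apply]
    refine Finset.sum_congr rfl fun q _ => ?_
    rw [map_smul, map_smul, bCreGen_smul, smul_apply, luneCoeff_coe, dressedCre]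
  · simp [h]

theorem kinOp_fermiState {s : Finset Momentum} (hs : fermiBall kF ⊆ s) :
    kinOp s (fermiState kF) = (kinEnergy (fermiBall kF) : ℂ) • fermiState kF := by
  refine lp.ext (funext fun S => ?_)
  rw [kinOp_apply_of_ann_eq_zero (fun q hq => ann_fermiState fun h => hq (hs h)),
    Fock.smul_apply]
  by_cases h : S = fermiBall kF
  · rw [h]
  · simp [fermiState, lp.single_apply, h]

/-! ### Occupied modes and the reduction to finitely many momentum transfers -/

theorem ann_plasmonState (hq : q ∉ fermiBall kF ∪ lune kF k) (M : ℕ) :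
    ann q (plasmonState kF k φ M) = 0 := by
  rw [Finset.mem_union, not_or] at hq
  have h1 : ann q * bCreGen kF k φ = bCreGen kF k φ * ann q := by
    rw [ann_mul_bCreGen, luneCoeff_of_notMem φ hq.2, zero_smul, add_zero]
  have h2 : Commute (ann q) (bCreGen kF k φ ^ M) := Commute.pow_right h1 M
  have h3 := congrArg (fun T : Fock →L[ℂ] Fock => T (fermiState kF)) h2.eq
  change ann q (plasmonState kF k φ M) = (bCreGen kF k φ ^ M) (ann q (fermiState kF)) at h3
  rw [h3, ann_fermiState hq.1, map_zero]

/-- The momenta transferred from the Fermi ball to the lune `L_k`. -/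
noncomputable def transfers (kF : ℝ) (k : Momentum) : Finset Momentum :=
  (lune kF k ×ˢ fermiBall kF).image fun x => x.1 - x.2

theorem sub_mem_transfers (hq : q ∈ lune kF k) (ha : a ∈ fermiBall kF) :
    q - a ∈ transfers kF k :=
  Finset.mem_image.mpr ⟨(q, a), Finset.mem_product.mpr ⟨hq, ha⟩, rfl⟩

theorem ne_zero_of_mem_transfers (h : l ∈ transfers kF k) : l ≠ 0 := by
  obtain ⟨⟨q, a⟩, hx, rfl⟩ := Finset.mem_image.mp h
  rw [Finset.mem_product] at hx
  intro h0
  rw [sub_eq_zero] at h0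
  exact notMem_fermiBall_of_mem_lune hx.1 (h0 ▸ hx.2)

theorem mem_transfers_self (hφ : φ ≠ 0) : k ∈ transfers kF k := by
  have : ∃ q, q ∈ lune kF k := by
    by_contra! h
    refine hφ (PiLp.ext fun q => absurd q.2 (h q))
  obtain ⟨q, hq⟩ := this
  simpa using sub_mem_transfers hq (sub_mem_fermiBall_of_mem_lune hq)

/-- If `b_{l,q}` does not annihilate the state, then `q` is occupied outside the ball, hence `q ∈
L_k`; with `q - l` in the ball, `l` is a transfer. -/
theorem quasiBosonic_plasmonState (hl : l ∉ transfers kF k) (M : ℕ) :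
    quasiBosonic kF V l (plasmonState kF k φ M) = 0 := by
  rw [quasiBosonic_eq, smul_apply, sum_apply, Finset.sum_eq_zero, smul_zero]
  intro q _
  change dressedCre V kF l q (cre (q - l) (ann q (plasmonState kF k φ M))) = 0
  rw [ann_plasmonState, map_zero, map_zero]
  rw [Finset.mem_union, not_or]
  refine ⟨notMem_fermiBall_of_mem_lune q.2, fun h => hl ?_⟩
  simpa using sub_mem_transfers h (sub_mem_fermiBall_of_mem_lune q.2)

/-- The part of the effective Hamiltonian that acts on the plasmon states. -/
noncomputable def truncatedHamiltonian (kF : ℝ) (V : Momentum → ℝ) (k : Momentum) :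
    Fock →L[ℂ] Fock :=
  kinOp (fermiBall kF ∪ lune kF k) + ∑ l ∈ transfers kF k, quasiBosonic kF V l

/-- The double commutator of the effective Hamiltonian with `b_k^*(φ)`. -/
noncomputable def doubleCommutator (φ : LuneSpace kF k) (V : Momentum → ℝ) : Fock →L[ℂ] Fock :=
  ∑ l ∈ transfers kF k, (2 : ℂ) • ∑ q : lune kF l, dressedCre V kF l q * doubleExchange φ l q

theorem truncatedHamiltonian_plasmonState {ek : ℝ} (hφ : φ ≠ 0)
    (hek : ((2 : ℂ) • EOp kF V k) φ = (ek : ℂ) • φ) (M : ℕ) :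
    truncatedHamiltonian kF V k (plasmonState kF k φ M) =
      ((kinEnergy (fermiBall kF) : ℂ) + ((M * ek : ℝ) : ℂ)) • plasmonState kF k φ M +
      (M.choose 2) • (bCreGen kF k φ ^ (M - 2)) (doubleCommutator φ V (fermiState kF)) := by
  have h1 := mul_pow_of_commutators
    (a := truncatedHamiltonian kF V k) (x := bCreGen kF k φ)
    (b := (2 : ℂ) • bCreGen kF k (hOp kF k φ) + ∑ l ∈ transfers kF k,
      (2 : ℂ) • ∑ q : lune kF l, dressedCre V kF l q * exchange φ l q)
    (c := doubleCommutator φ V)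
    (by
      rw [truncatedHamiltonian, add_mul, mul_add, kinOp_mul_bCreGen φ Finset.subset_union_right
        Finset.subset_union_left, Finset.sum_mul, Finset.mul_sum,
        Finset.sum_congr rfl fun l _ => quasiBosonic_mul_bCreGen φ V l, Finset.sum_add_distrib]
      abel)
    (by
      rw [add_mul, mul_add, smul_mul_assoc, bCreGen_mul_bCreGen, mul_smul_comm, Finset.sum_mul,
        Finset.mul_sum, Finset.sum_congr rfl fun l _ => sum_dressed_exchange_mul_bCreGen φ V l,
        Finset.sum_add_distrib, doubleCommutator]
      abel)
    (by
      rw [doubleCommutator, Finset.sum_mul, Finset.mul_sum,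
        Finset.sum_congr rfl fun l _ => sum_dressed_doubleExchange_mul_bCreGen φ V l]) M
  have h2 : truncatedHamiltonian kF V k (fermiState kF) =
      (kinEnergy (fermiBall kF) : ℂ) • fermiState kF := by
    rw [truncatedHamiltonian, add_apply, kinOp_fermiState Finset.subset_union_left, sum_apply,
      Finset.sum_eq_zero fun l _ => quasiBosonic_fermiState V l, add_zero]
  -- The kinetic part gives `h_k φ` and the term `l = k` gives `(Ẽ_k - h_k) φ`; they add up to `Ẽ_k
  -- φ`, and here the eigenvalue equation enters.
  have h3 : ((2 : ℂ) • bCreGen kF k (hOp kF k φ) + ∑ l ∈ transfers kF k,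
      (2 : ℂ) • ∑ q : lune kF l, dressedCre V kF l q * exchange φ l q) (fermiState kF) =
      (ek : ℂ) • bCreGen kF k φ (fermiState kF) := by
    rw [add_apply, sum_apply, Finset.sum_congr rfl fun l _ => sum_dressed_exchange_fermiState φ V l,
      Finset.sum_ite_eq', if_pos (mem_transfers_self φ hφ), smul_apply, ← smul_add, ← add_apply,
      ← bCreGen_add, sub_apply, add_sub_cancel]
    have e : (2 : ℂ) • bCreGen kF k (EOp kF V k φ) = (ek : ℂ) • bCreGen kF k φ := by
      rw [← bCreGen_smul, ← bCreGen_smul, ← hek, smul_apply]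
    exact congrArg (fun T : Fock →L[ℂ] Fock => T (fermiState kF)) e
  have h4 := congrArg (fun T : Fock →L[ℂ] Fock => T (fermiState kF)) h1
  change truncatedHamiltonian kF V k (plasmonState kF k φ M) =
    (bCreGen kF k φ ^ M) (truncatedHamiltonian kF V k (fermiState kF)) +
    M • (bCreGen kF k φ ^ (M - 1)) (((2 : ℂ) • bCreGen kF k (hOp kF k φ) + ∑ l ∈ transfers kF k,
      (2 : ℂ) • ∑ q : lune kF l, dressedCre V kF l q * exchange φ l q) (fermiState kF)) +
    (M.choose 2) • (bCreGen kF k φ ^ (M - 2)) (doubleCommutator φ V (fermiState kF)) at h4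
  rw [h4, h2, h3, map_smul, map_smul, add_smul]
  congr 1
  change _ + M • (ek : ℂ) • (bCreGen kF k φ ^ (M - 1) * bCreGen kF k φ) (fermiState kF) = _
  rcases M with _ | M
  · simp [plasmonState]
  · rw [Nat.add_sub_cancel, ← pow_succ, ← Nat.cast_smul_eq_nsmul ℂ, smul_smul, Complex.ofReal_mul,
      Complex.ofReal_natCast]
    rfl

theorem bCreGen_apply (Ψ : Fock) : bCreGen kF k φ Ψ =
    ∑ p ∈ lune kF k, luneCoeff φ p • cre p (ann (p - k) Ψ) := by
  rw [bCreGen_eq, sum_apply]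
  rfl

theorem bCreGen_mem_sector (φ : LuneSpace kF k) {m h : ℕ} {Ψ : Fock}
    (hΨ : Ψ ∈ sector (fermiBall kF) m h) :
    bCreGen kF k φ Ψ ∈ sector (fermiBall kF) (m + 1) (h + 1) := by
  rw [bCreGen_apply]
  refine Submodule.sum_mem _ fun p hp => Submodule.smul_mem _ _ ?_
  exact cre_mem_sector (notMem_fermiBall_of_mem_lune hp)
    (ann_mem_sector (sub_mem_fermiBall_of_mem_lune hp) hΨ)

theorem bCreGen_pow_mem_sector {m h : ℕ} {Ψ : Fock} (hΨ : Ψ ∈ sector (fermiBall kF) m h) (n : ℕ) :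
    (bCreGen kF k φ ^ n) Ψ ∈ sector (fermiBall kF) (m + n) (h + n) := by
  induction n with
  | zero => exact hΨ
  | succ n ih =>
    rw [pow_succ']
    exact bCreGen_mem_sector φ ih

theorem plasmonState_mem_sector (M : ℕ) :
    plasmonState kF k φ M ∈ sector (fermiBall kF) M M := by
  have h := bCreGen_pow_mem_sector φ (fermiState_mem_sector kF) M
  rwa [zero_add] at h

theorem plasmonState_mem_effDomain (M : ℕ) : plasmonState kF k φ M ∈ effDomain kF V := by
  refine ⟨(sector_le_excitationSpace kF M (plasmonState_mem_sector φ M)).1, ?_, ?_⟩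
  · have h := lp.memℓp (kinOp (fermiBall kF ∪ lune kF k) (plasmonState kF k φ M))
    convert h using 1
    funext S
    rw [kinOp_apply_of_ann_eq_zero fun q hq => ann_plasmonState φ hq M]
  · refine summable_of_ne_finset_zero
      (s := (transfers kF k).subtype (· ≠ 0)) fun l hl => quasiBosonic_plasmonState φ V ?_ M
    simpa using hl

theorem effHamiltonian_plasmonState (M : ℕ) :
    effHamiltonian kF V ⟨plasmonState kF k φ M, plasmonState_mem_effDomain φ V M⟩ =
      truncatedHamiltonian kF V k (plasmonState kF k φ M) -
        (kinEnergy (fermiBall kF) : ℂ) • plasmonState kF k φ M := by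
  have h1 : (⟨fun S => (kinEnergy S : ℂ) * plasmonState kF k φ M S,
      (plasmonState_mem_effDomain φ V M).2.1⟩ : Fock) =
      kinOp (fermiBall kF ∪ lune kF k) (plasmonState kF k φ M) := by
    refine lp.ext (funext fun S => ?_)
    rw [kinOp_apply_of_ann_eq_zero fun q hq => ann_plasmonState φ hq M]
  have h2 : ∑' l : {l : Momentum // l ≠ 0}, quasiBosonic kF V l (plasmonState kF k φ M) =
      ∑ l ∈ transfers kF k, quasiBosonic kF V l (plasmonState kF k φ M) := by
    rw [tsum_eq_sum (s := (transfers kF k).subtype (· ≠ 0)) fun l hl =>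
      quasiBosonic_plasmonState φ V (by simpa using hl) M]
    exact Finset.sum_subtype_of_mem (fun l => quasiBosonic kF V l (plasmonState kF k φ M))
      fun l hl => ne_zero_of_mem_transfers hl
  change ((⟨fun S => (kinEnergy S : ℂ) * plasmonState kF k φ M S,
      (plasmonState_mem_effDomain φ V M).2.1⟩ : Fock) -
        (kinEnergy (fermiBall kF) : ℂ) • plasmonState kF k φ M) +
      ∑' l : {l : Momentum // l ≠ 0}, quasiBosonic kF V l (plasmonState kF k φ M) = _
  rw [h1, h2, truncatedHamiltonian, add_apply, sum_apply]
  abel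

theorem norm_effHamiltonian_sub_eq {ek : ℝ} (hφ : φ ≠ 0)
    (hek : ((2 : ℂ) • EOp kF V k) φ = (ek : ℂ) • φ) (M : ℕ) :
    ∃ hdom : normalized (plasmonState kF k φ M) ∈ (effHamiltonian kF V).domain,
      ‖effHamiltonian kF V ⟨normalized (plasmonState kF k φ M), hdom⟩ -
          ((M * ek : ℝ) : ℂ) • normalized (plasmonState kF k φ M)‖ =
        ‖plasmonState kF k φ M‖⁻¹ * (M.choose 2 *
          ‖(bCreGen kF k φ ^ (M - 2)) (doubleCommutator φ V (fermiState kF))‖) := by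
  have hd := plasmonState_mem_effDomain φ V M
  refine ⟨Submodule.smul_mem _ _ hd, ?_⟩
  have h1 : effHamiltonian kF V ⟨normalized (plasmonState kF k φ M), Submodule.smul_mem _ _ hd⟩ =
      ((‖plasmonState kF k φ M‖⁻¹ : ℝ) : ℂ) •
        effHamiltonian kF V ⟨plasmonState kF k φ M, hd⟩ :=
    (effHamiltonian kF V).map_smul _ ⟨plasmonState kF k φ M, hd⟩
  have h2 : ((‖plasmonState kF k φ M‖⁻¹ : ℝ) : ℂ) •
        effHamiltonian kF V ⟨plasmonState kF k φ M, hd⟩ -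
        ((M * ek : ℝ) : ℂ) • normalized (plasmonState kF k φ M) =
      ((‖plasmonState kF k φ M‖⁻¹ : ℝ) : ℂ) • (M.choose 2) •
        (bCreGen kF k φ ^ (M - 2)) (doubleCommutator φ V (fermiState kF)) := by
    rw [effHamiltonian_plasmonState, truncatedHamiltonian_plasmonState φ V hφ hek, normalized,
      smul_comm (((M * ek : ℝ) : ℂ)), ← smul_sub, add_smul]
    congr 1
    abel
  rw [h1, h2, norm_smul, ← Nat.cast_smul_eq_nsmul ℂ, norm_smul]
  simp

end PlasmonStates

end Plasmon

namespace Plasmon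

/-! ### Norm bounds -/

theorem norm_cre_apply_le (p : Momentum) (Ψ : Fock) : ‖cre p Ψ‖ ≤ ‖Ψ‖ := by
  have h : ‖ann p‖ ≤ 1 := LinearMap.mkContinuous_norm_le _ zero_le_one _
  have h' : ‖cre p‖ ≤ 1 := by
    rw [cre, LinearIsometryEquiv.norm_map]; exact h
  simpa using (cre p).le_of_opNorm_le h' Ψ

section NormBounds

variable {kF : ℝ} {k : Momentum} (φ : LuneSpace kF k)

theorem sum_norm_luneCoeff_sq : ∑ p ∈ lune kF k, ‖luneCoeff φ p‖ ^ 2 = ‖φ‖ ^ 2 := by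
  rw [EuclideanSpace.norm_sq_eq, ← Finset.sum_coe_sort (lune kF k)]
  exact Finset.sum_congr rfl fun p _ => by rw [luneCoeff_coe]

/-- The adjoint `b_k(φ)` of `b_k^*(φ)`. -/
noncomputable def bAnnGen : Fock →L[ℂ] Fock :=
  ∑ p ∈ lune kF k, (starRingEnd ℂ) (luneCoeff φ p) • bAnn k p

theorem bAnnGen_apply (Ψ : Fock) : bAnnGen φ Ψ =
    ∑ p ∈ lune kF k, (starRingEnd ℂ) (luneCoeff φ p) • cre (p - k) (ann p Ψ) := by
  rw [bAnnGen, sum_apply]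
  rfl

theorem inner_bCreGen_left (Ψ Φ : Fock) :
    inner ℂ (bCreGen kF k φ Ψ) Φ = inner ℂ Ψ (bAnnGen φ Φ) := by
  rw [bCreGen_apply, bAnnGen_apply, sum_inner, inner_sum]
  refine Finset.sum_congr rfl fun p _ => ?_
  rw [inner_smul_left, inner_smul_right, inner_cre_left, inner_cre_right]

theorem inner_bCreGen_right (Ψ Φ : Fock) :
    inner ℂ Ψ (bCreGen kF k φ Φ) = inner ℂ (bAnnGen φ Ψ) Φ := by
  rw [← inner_conj_symm, inner_bCreGen_left, inner_conj_symm]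

theorem inner_exchange_self (p : Momentum) (Ψ : Fock) :
    inner ℂ Ψ (exchange φ k p Ψ) =
      luneCoeff φ p * ((‖Ψ‖ ^ 2 - ‖ann p Ψ‖ ^ 2 - ‖cre (p - k) Ψ‖ ^ 2 : ℝ) : ℂ) := by
  have h0 : ∀ Φ : Fock, inner ℂ Φ Φ = ((‖Φ‖ ^ 2 : ℝ) : ℂ) := fun Φ => by
    rw [inner_self_eq_norm_sq_to_K]; norm_cast
  have h1 : cre (p - k) (ann (p - k) Ψ) = Ψ - ann (p - k) (cre (p - k) Ψ) := by
    have h := congrArg (fun T : Fock →L[ℂ] Fock => T Ψ) (ann_mul_cre (p - k) (p - k))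
    rw [if_pos rfl] at h
    change ann (p - k) (cre (p - k) Ψ) = Ψ - cre (p - k) (ann (p - k) Ψ) at h
    rw [h, sub_sub_cancel]
  change inner ℂ Ψ ((-luneCoeff φ (p - k + k)) • cre (p - k + k) (ann p Ψ) +
    luneCoeff φ p • cre (p - k) (ann (p - k) Ψ)) = _
  rw [sub_add_cancel, inner_add_right, inner_smul_right, inner_smul_right, inner_cre_right, h0, h1,
    inner_sub_right, h0, ← inner_cre_left, h0]
  push_cast
  ring

/-- For `l = k` the commutator of `b_{k,p}` with `b_k^*(φ)` is diagonal: `φ_p` times one minus the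
number of particles at `p` and of holes at `p - k`. Without these Pauli terms this would be the
bosonic identity. -/
theorem norm_bCreGen_sq (Ψ : Fock) : ‖bCreGen kF k φ Ψ‖ ^ 2 = ‖bAnnGen φ Ψ‖ ^ 2 +
    ∑ p ∈ lune kF k, ‖luneCoeff φ p‖ ^ 2 *
      (‖Ψ‖ ^ 2 - ‖ann p Ψ‖ ^ 2 - ‖cre (p - k) Ψ‖ ^ 2) := by
  have h0 : ∀ Φ : Fock, ((‖Φ‖ ^ 2 : ℝ) : ℂ) = inner ℂ Φ Φ := fun Φ => by
    rw [inner_self_eq_norm_sq_to_K]; norm_cast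
  have h1 : bAnnGen φ (bCreGen kF k φ Ψ) = bCreGen kF k φ (bAnnGen φ Ψ) +
      ∑ p ∈ lune kF k, (starRingEnd ℂ) (luneCoeff φ p) • exchange φ k p Ψ := by
    have h2 : bAnnGen φ * bCreGen kF k φ = bCreGen kF k φ * bAnnGen φ +
        ∑ p ∈ lune kF k, (starRingEnd ℂ) (luneCoeff φ p) • exchange φ k p := by
      rw [bAnnGen, Finset.sum_mul, Finset.mul_sum, ← Finset.sum_add_distrib]
      refine Finset.sum_congr rfl fun p _ => ?_
      rw [smul_mul_assoc, bAnn_mul_bCreGen, mul_smul_comm, smul_add, exchange]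
    have h3 := congrArg (fun T : Fock →L[ℂ] Fock => T Ψ) h2
    rw [add_apply, sum_apply] at h3
    exact h3
  have h4 : ((‖bCreGen kF k φ Ψ‖ ^ 2 : ℝ) : ℂ) = ((‖bAnnGen φ Ψ‖ ^ 2 +
    ∑ p ∈ lune kF k, ‖luneCoeff φ p‖ ^ 2 *
      (‖Ψ‖ ^ 2 - ‖ann p Ψ‖ ^ 2 - ‖cre (p - k) Ψ‖ ^ 2) : ℝ) : ℂ) := by
    rw [h0, inner_bCreGen_left, h1, inner_add_right, inner_bCreGen_right, ← h0, inner_sum,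
      Complex.ofReal_add, Complex.ofReal_sum]
    congr 1
    refine Finset.sum_congr rfl fun p _ => ?_
    rw [inner_smul_right, inner_exchange_self, ← mul_assoc, Complex.ofReal_mul, mul_comm _ (luneCoeff φ p),
      Complex.mul_conj, Complex.normSq_eq_norm_sq]
  exact_mod_cast h4

theorem norm_bAnnGen_sq_le {m h : ℕ} {Ψ : Fock} (hΨ : Ψ ∈ sector (fermiBall kF) m h) :
    ‖bAnnGen φ Ψ‖ ^ 2 ≤ m * ‖φ‖ ^ 2 * ‖Ψ‖ ^ 2 := by
  have h1 : ‖bAnnGen φ Ψ‖ ≤ ∑ p ∈ lune kF k, ‖luneCoeff φ p‖ * ‖ann p Ψ‖ := by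
    rw [bAnnGen_apply]
    refine (norm_sum_le _ _).trans (Finset.sum_le_sum fun p _ => ?_)
    rw [norm_smul, RCLike.norm_conj]
    gcongr
    exact norm_cre_apply_le _ _
  have h2 := sum_norm_ann_sq_le (s := lune kF k) (fun p => notMem_fermiBall_of_mem_lune) hΨ
  calc ‖bAnnGen φ Ψ‖ ^ 2 ≤ (∑ p ∈ lune kF k, ‖luneCoeff φ p‖ * ‖ann p Ψ‖) ^ 2 := by gcongr
    _ ≤ (∑ p ∈ lune kF k, ‖luneCoeff φ p‖ ^ 2) * ∑ p ∈ lune kF k, ‖ann p Ψ‖ ^ 2 :=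
      Finset.sum_mul_sq_le_sq_mul_sq _ _ _
    _ ≤ ‖φ‖ ^ 2 * (m * ‖Ψ‖ ^ 2) := by
      rw [sum_norm_luneCoeff_sq]
      gcongr
    _ = _ := by ring

theorem norm_bCreGen_sq_le {m h : ℕ} {Ψ : Fock} (hΨ : Ψ ∈ sector (fermiBall kF) m h) :
    ‖bCreGen kF k φ Ψ‖ ^ 2 ≤ (m + 1) * ‖φ‖ ^ 2 * ‖Ψ‖ ^ 2 := by
  have h1 : ∑ p ∈ lune kF k, ‖luneCoeff φ p‖ ^ 2 *
      (‖Ψ‖ ^ 2 - ‖ann p Ψ‖ ^ 2 - ‖cre (p - k) Ψ‖ ^ 2) ≤ ‖φ‖ ^ 2 * ‖Ψ‖ ^ 2 := by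
    rw [← sum_norm_luneCoeff_sq, Finset.sum_mul]
    refine Finset.sum_le_sum fun p _ => ?_
    gcongr
    nlinarith [sq_nonneg ‖ann p Ψ‖, sq_nonneg ‖cre (p - k) Ψ‖]
  rw [norm_bCreGen_sq]
  linarith [norm_bAnnGen_sq_le φ hΨ]

theorem sum_norm_cre_sub_sq_le {m h : ℕ} {Ψ : Fock} (hΨ : Ψ ∈ sector (fermiBall kF) m h) :
    ∑ p ∈ lune kF k, ‖cre (p - k) Ψ‖ ^ 2 ≤ h * ‖Ψ‖ ^ 2 := by
  rw [← Finset.sum_image (f := fun a => ‖cre a Ψ‖ ^ 2) (g := fun p => p - k)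
    fun x _ y _ hxy => sub_left_injective hxy]
  refine sum_norm_cre_sq_le (fun a ha => ?_) hΨ
  obtain ⟨p, hp, rfl⟩ := Finset.mem_image.mp ha
  exact sub_mem_fermiBall_of_mem_lune hp

/-- Each particle and each hole blocks at most a weight `κ` of `φ`, so the Pauli terms cost at most
`κ (m + h)`. -/
theorem le_norm_bCreGen_sq {m h : ℕ} {Ψ : Fock} (hΨ : Ψ ∈ sector (fermiBall kF) m h) {κ : ℝ}
    (hκ : ∀ p, ‖luneCoeff φ p‖ ^ 2 ≤ κ) :
    ‖bAnnGen φ Ψ‖ ^ 2 + (‖φ‖ ^ 2 - κ * (m + h)) * ‖Ψ‖ ^ 2 ≤ ‖bCreGen kF k φ Ψ‖ ^ 2 := by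
  have h0 : 0 ≤ κ := (sq_nonneg _).trans (hκ 0)
  have h1 : ‖φ‖ ^ 2 * ‖Ψ‖ ^ 2 - κ * (∑ p ∈ lune kF k, ‖ann p Ψ‖ ^ 2) -
      κ * (∑ p ∈ lune kF k, ‖cre (p - k) Ψ‖ ^ 2) ≤
      ∑ p ∈ lune kF k, ‖luneCoeff φ p‖ ^ 2 *
        (‖Ψ‖ ^ 2 - ‖ann p Ψ‖ ^ 2 - ‖cre (p - k) Ψ‖ ^ 2) := by
    rw [← sum_norm_luneCoeff_sq, Finset.sum_mul, Finset.mul_sum, Finset.mul_sum,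
      ← Finset.sum_sub_distrib, ← Finset.sum_sub_distrib]
    refine Finset.sum_le_sum fun p _ => ?_
    have h2 := mul_le_mul_of_nonneg_right (hκ p) (sq_nonneg ‖ann p Ψ‖)
    have h3 := mul_le_mul_of_nonneg_right (hκ p) (sq_nonneg ‖cre (p - k) Ψ‖)
    linarith
  have h2 := mul_le_mul_of_nonneg_left
    (sum_norm_ann_sq_le (s := lune kF k) (fun p => notMem_fermiBall_of_mem_lune) hΨ) h0
  have h3 := mul_le_mul_of_nonneg_left (sum_norm_cre_sub_sq_le (k := k) hΨ) h0
  rw [norm_bCreGen_sq]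
  linarith

/-- Starting from two particles, the successive bosonic factors are `3, 4, …, n + 2`, with product
`(n + 2)!/2`. -/
theorem norm_bCreGen_pow_sq_le (hφ : ‖φ‖ = 1) {Ψ : Fock}
    (hΨ : Ψ ∈ sector (fermiBall kF) 2 2) (n : ℕ) :
    2 * ‖(bCreGen kF k φ ^ n) Ψ‖ ^ 2 ≤ (n + 2).factorial * ‖Ψ‖ ^ 2 := by
  induction n with
  | zero => simp
  | succ n ih =>
    have h1 := norm_bCreGen_sq_le φ (bCreGen_pow_mem_sector φ hΨ n)
    have h2 : (bCreGen kF k φ ^ (n + 1)) Ψ = bCreGen kF k φ ((bCreGen kF k φ ^ n) Ψ) := by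
      rw [pow_succ']; rfl
    rw [← h2, hφ] at h1
    rw [show n + 1 + 2 = (n + 2) + 1 by ring, Nat.factorial_succ]
    generalize ‖(bCreGen kF k φ ^ n) Ψ‖ ^ 2 = a at h1 ih
    generalize ‖(bCreGen kF k φ ^ (n + 1)) Ψ‖ ^ 2 = b at h1
    generalize ‖Ψ‖ ^ 2 = c at ih
    generalize (n + 2).factorial = f at ih
    push_cast at h1 ⊢
    have h3 := mul_le_mul_of_nonneg_left ih (by positivity : (0 : ℝ) ≤ n + 3)
    linarith

theorem plasmonState_succ (M : ℕ) :
    plasmonState kF k φ (M + 1) = bCreGen kF k φ (plasmonState kF k φ M) := by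
  rw [plasmonState, pow_succ']; rfl

/-- The bosonic factor `n + 1` must be recovered from `‖b_k(φ) Ψ_n‖²`. Since `⟨b_k(φ) Ψ_{n+1}, Ψ_n⟩
= ‖Ψ_{n+1}‖²`, Cauchy–Schwarz bounds that annihilation norm below by the preceding ratio of norms,
and induction applies. -/
theorem norm_plasmonState_succ_sq_ge (hφ : ‖φ‖ = 1) {κ : ℝ}
    (hκ : ∀ p, ‖luneCoeff φ p‖ ^ 2 ≤ κ) (n : ℕ) :
    (n + 1) * (1 - 2 * κ * n) * ‖plasmonState kF k φ n‖ ^ 2 ≤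
      ‖plasmonState kF k φ (n + 1)‖ ^ 2 := by
  have h0 : 0 ≤ κ := (sq_nonneg _).trans (hκ 0)
  induction n with
  | zero =>
    have h1 := le_norm_bCreGen_sq φ (plasmonState_mem_sector φ 0) hκ
    rw [← plasmonState_succ, hφ] at h1
    have h2 := sq_nonneg ‖bAnnGen φ (plasmonState kF k φ 0)‖
    generalize ‖bAnnGen φ (plasmonState kF k φ 0)‖ ^ 2 = b at h1 h2
    generalize ‖plasmonState kF k φ (0 + 1)‖ ^ 2 = w at h1
    generalize ‖plasmonState kF k φ 0‖ ^ 2 = u at h1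
    push_cast at h1 ⊢
    linarith
  | succ n ih =>
    have h1 := le_norm_bCreGen_sq φ (plasmonState_mem_sector φ (n + 1)) hκ
    rw [← plasmonState_succ φ (n + 1), hφ] at h1
    have h2 : ‖plasmonState kF k φ (n + 1)‖ ^ 2 ≤
        ‖bAnnGen φ (plasmonState kF k φ (n + 1))‖ * ‖plasmonState kF k φ n‖ := by
      have h3 : inner ℂ (bAnnGen φ (plasmonState kF k φ (n + 1))) (plasmonState kF k φ n) =
          ((‖plasmonState kF k φ (n + 1)‖ ^ 2 : ℝ) : ℂ) := by
        rw [← inner_bCreGen_right, ← plasmonState_succ, inner_self_eq_norm_sq_to_K]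
        norm_cast
      have h4 := norm_inner_le_norm (𝕜 := ℂ) (bAnnGen φ (plasmonState kF k φ (n + 1)))
        (plasmonState kF k φ n)
      rwa [h3, Complex.norm_real, Real.norm_of_nonneg (sq_nonneg _)] at h4
    generalize ‖plasmonState kF k φ n‖ = u at h2 ih
    generalize ‖plasmonState kF k φ (n + 1)‖ = w at h1 h2 ih
    generalize ‖bAnnGen φ (plasmonState kF k φ (n + 1))‖ = b at h1 h2
    generalize ‖plasmonState kF k φ (n + 1 + 1)‖ = z at h1
    have h5 : (n + 1) * (1 - 2 * κ * (n + 1)) * w ^ 2 ≤ b ^ 2 := by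
      have h6 : (n + 1) * (1 - 2 * κ * (n + 1)) * u ^ 2 ≤ w ^ 2 := by
        refine le_trans ?_ ih
        gcongr
        linarith
      -- The bound on `b` comes from dividing by `u²`; when `u` vanishes, so does `w`.
      rcases eq_or_ne u 0 with hu | hu
      · have : w = 0 := by
          rw [hu, mul_zero] at h2
          nlinarith [sq_nonneg w]
        rw [this]; simpa using sq_nonneg b
      · have hu' : 0 < u ^ 2 := by positivity
        have h7 : w ^ 2 * w ^ 2 ≤ b ^ 2 * u ^ 2 := by
          have := mul_self_le_mul_self (sq_nonneg w) h2
          linarith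
        have h8 := mul_le_mul_of_nonneg_right h6 (sq_nonneg w)
        refine le_of_mul_le_mul_right ?_ hu'
        linarith
    push_cast at h1 ⊢
    linarith

theorem norm_plasmonState_sq_ge (hφ : ‖φ‖ = 1) {κ : ℝ}
    (hκ : ∀ p, ‖luneCoeff φ p‖ ^ 2 ≤ κ) {M : ℕ} (hM : 4 * κ * M ^ 2 ≤ 1) :
    M.factorial / 2 ≤ ‖plasmonState kF k φ M‖ ^ 2 := by
  have h0 : 0 ≤ κ := (sq_nonneg _).trans (hκ 0)
  rcases Nat.eq_zero_or_pos M with rfl | hM0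
  · have : plasmonState kF k φ 0 = fermiState kF := rfl
    rw [this, norm_fermiState]; norm_num
  have hM1 : (1 : ℝ) ≤ M := by exact_mod_cast hM0
  have ht : 2 * κ * M ≤ 1 / 2 := by nlinarith [mul_nonneg h0 (sub_nonneg.mpr hM1)]
  have key : ∀ n ≤ M, n.factorial * (1 - 2 * κ * M) ^ n ≤ ‖plasmonState kF k φ n‖ ^ 2 := by
    intro n hn
    induction n with
    | zero =>
      have : plasmonState kF k φ 0 = fermiState kF := rfl
      rw [this, norm_fermiState]; norm_num
    | succ n ih =>
      have h1 : (n : ℝ) ≤ M := by exact_mod_cast (Nat.le_succ n).trans hn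
      refine le_trans ?_ (norm_plasmonState_succ_sq_ge φ hφ hκ n)
      have h3 := ih (by omega)
      rw [Nat.factorial_succ, pow_succ]
      push_cast
      calc ((n : ℝ) + 1) * n.factorial * ((1 - 2 * κ * M) ^ n * (1 - 2 * κ * M))
          = (n + 1) * (1 - 2 * κ * M) * (n.factorial * (1 - 2 * κ * M) ^ n) := by ring
        _ ≤ (n + 1) * (1 - 2 * κ * M) * ‖plasmonState kF k φ n‖ ^ 2 := by
          gcongr
          have : 0 ≤ 1 - 2 * κ * M := by linarith
          positivity
        _ ≤ _ := by gcongr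
  refine le_trans ?_ (key M le_rfl)
  -- Bernoulli's inequality: `(1 - 2κM)^M ≥ 1 - 2κM² ≥ 1/2`.
  have h4 := one_add_mul_le_pow (a := -(2 * κ * M)) (by linarith) M
  have h5 : (1 : ℝ) / 2 ≤ (1 - 2 * κ * M) ^ M := by
    rw [← sub_eq_add_neg] at h4
    refine le_trans ?_ h4
    linarith
  have h6 : (0 : ℝ) ≤ M.factorial := by positivity
  nlinarith

/-! ### The double commutator on the Fermi state -/

variable (V : Momentum → ℝ)

/-- The vector `b_l^*((Ẽ_l - h_l) e_q) ψ_FS`, extended by zero in `q`. -/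
noncomputable def dressedPair (kF : ℝ) (l q : Momentum) : Fock :=
  if h : q ∈ lune kF l then dressedCre V kF l ⟨q, h⟩ (fermiState kF) else 0

/-- Both factors create only particles and holes, so they commute. With the dressed pair acting
first, its norm is a one-body quantity, and the outer pair can be moved to the other side of an
inner product. -/
theorem dressedCre_doubleExchange_fermiState {l : Momentum} (q : lune kF l) :
    (dressedCre V kF l q * doubleExchange φ l q) (fermiState kF) =
      (-2 * (luneCoeff φ q * luneCoeff φ (q - l + k))) •
        cre (q - l + k) (ann (q - k) (dressedPair V kF l q)) := by
  have h1 : dressedCre V kF l q * doubleExchange φ l q =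
      doubleExchange φ l q * dressedCre V kF l q := by
    rw [doubleExchange]
    by_cases hq : (q : Momentum) ∈ lune kF k
    · by_cases hr : (q : Momentum) - l + k ∈ lune kF k
      · rw [smul_mul_assoc, dressedCre, cre_mul_ann_mul_bCreGen _
          (notMem_fermiBall_of_mem_lune hr) (sub_mem_fermiBall_of_mem_lune hq), mul_smul_comm]
      · simp [luneCoeff_of_notMem φ hr]
    · simp [luneCoeff_of_notMem φ hq]
  rw [h1, dressedPair, dif_pos q.2]
  rfl

/-- The coefficient `luneCoeff φ (q - l + k)` restricts `l`; substituting `r = q - l + k` turns the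
sum over transfers into a sum over the lune. -/
theorem doubleCommutator_fermiState : doubleCommutator φ V (fermiState kF) =
    ∑ q ∈ lune kF k, ∑ r ∈ lune kF k, (-4 * (luneCoeff φ q * luneCoeff φ r)) •
      cre r (ann (q - k) (dressedPair V kF (q + k - r) q)) := by
  set t : Momentum → Momentum → Fock := fun l q =>
    (-4 * (luneCoeff φ q * luneCoeff φ (q - l + k))) •
      cre (q - l + k) (ann (q - k) (dressedPair V kF l q)) with ht
  have h1 : doubleCommutator φ V (fermiState kF) =
      ∑ l ∈ transfers kF k, ∑ q ∈ lune kF k, t l q := by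
    rw [doubleCommutator, sum_apply]
    refine Finset.sum_congr rfl fun l _ => ?_
    have h2 : ∑ q ∈ lune kF l, t l q = ∑ q ∈ lune kF k, t l q := by
      rw [← Finset.sum_subset (Finset.inter_subset_left : lune kF l ∩ lune kF k ⊆ _),
        ← Finset.sum_subset (Finset.inter_subset_right : lune kF l ∩ lune kF k ⊆ _)]
      · intro q hq hq'
        have : q ∉ lune kF l := fun h => hq' (Finset.mem_inter.mpr ⟨h, hq⟩)
        simp [ht, dressedPair, this]
      · intro q hq hq'
        have : q ∉ lune kF k := fun h => hq' (Finset.mem_inter.mpr ⟨hq, h⟩)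
        simp [ht, luneCoeff_of_notMem φ this]
    rw [← h2, smul_apply, sum_apply, Finset.smul_sum, ← Finset.sum_coe_sort (lune kF l)]
    refine Finset.sum_congr rfl fun q _ => ?_
    rw [dressedCre_doubleExchange_fermiState, smul_smul, ht]
    congr 1
    ring
  rw [h1, Finset.sum_comm]
  refine Finset.sum_congr rfl fun q hq => ?_
  have h3 : (lune kF k).image (fun r => q + k - r) ⊆ transfers kF k := by
    intro l hl
    obtain ⟨r, hr, rfl⟩ := Finset.mem_image.mp hl
    have := sub_mem_transfers hq (sub_mem_fermiBall_of_mem_lune hr)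
    rwa [show q - (r - k) = q + k - r by abel] at this
  rw [← Finset.sum_subset h3, Finset.sum_image fun x _ y _ hxy => sub_right_injective hxy]
  · refine Finset.sum_congr rfl fun r _ => ?_
    simp only [ht]
    rw [show q - (q + k - r) + k = r by abel]
  · intro l _ hl
    have : q - l + k ∉ lune kF k := fun h => hl (Finset.mem_image.mpr ⟨_, h, by abel⟩)
    simp [ht, luneCoeff_of_notMem φ this]

theorem dressedPair_mem_sector (l q : Momentum) :
    dressedPair V kF l q ∈ sector (fermiBall kF) 1 1 := by
  unfold dressedPair
  split_ifs with h
  · exact bCreGen_mem_sector _ (fermiState_mem_sector kF)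
  · exact Submodule.zero_mem _

theorem doubleCommutator_mem_sector :
    doubleCommutator φ V (fermiState kF) ∈ sector (fermiBall kF) 2 2 := by
  rw [doubleCommutator_fermiState]
  refine Submodule.sum_mem _ fun q hq => Submodule.sum_mem _ fun r hr =>
    Submodule.smul_mem _ _ ?_
  exact cre_mem_sector (notMem_fermiBall_of_mem_lune hr)
    (ann_mem_sector (sub_mem_fermiBall_of_mem_lune hq) (dressedPair_mem_sector V _ _))

theorem norm_cre_ann_comm {r b : Momentum} (h : r ≠ b) (Z : Fock) :
    ‖cre b (ann r Z)‖ = ‖ann r (cre b Z)‖ := by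
  have h1 := congrArg (fun T : Fock →L[ℂ] Fock => T Z) (ann_mul_cre r b)
  rw [if_neg h, zero_sub] at h1
  change ann r (cre b Z) = -cre b (ann r Z) at h1
  rw [h1, norm_neg]

theorem sum_norm_cre_ann_sq_le {m h : ℕ} {Z : Fock}
    (hZ : Z ∈ sector (fermiBall kF) m (h + 1)) :
    ∑ q ∈ lune kF k, ∑ r ∈ lune kF k, ‖cre (q - k) (ann r Z)‖ ^ 2 ≤
      m * ((h + 1 : ℕ) * ‖Z‖ ^ 2) := by
  calc ∑ q ∈ lune kF k, ∑ r ∈ lune kF k, ‖cre (q - k) (ann r Z)‖ ^ 2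
      ≤ ∑ q ∈ lune kF k, m * ‖cre (q - k) Z‖ ^ 2 := by
        refine Finset.sum_le_sum fun q hq => ?_
        have hb := sub_mem_fermiBall_of_mem_lune hq
        refine le_trans (Finset.sum_le_sum fun r hr => ?_)
          (sum_norm_ann_sq_le (s := lune kF k) (fun p => notMem_fermiBall_of_mem_lune)
            (cre_hole_mem_sector hb hZ))
        rw [norm_cre_ann_comm]
        rintro rfl
        exact notMem_fermiBall_of_mem_lune hr hb
    _ ≤ _ := by
      rw [← Finset.mul_sum]
      gcongr
      exact sum_norm_cre_sub_sq_le hZ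

/-- A duality argument that avoids the triangle inequality over pairs `(q, r)`: in `⟨Z, Z⟩` the
outer operators are moved onto the left `Z`, and Cauchy–Schwarz over `(q, r)` leaves particle and
hole counts of `Z`. -/
theorem norm_doubleCommutator_fermiState_sq_le :
    ‖doubleCommutator φ V (fermiState kF)‖ ^ 2 ≤ 64 * ∑ q ∈ lune kF k, ∑ r ∈ lune kF k,
      (‖luneCoeff φ q‖ * ‖luneCoeff φ r‖ * ‖dressedPair V kF (q + k - r) q‖) ^ 2 := by
  set Z := doubleCommutator φ V (fermiState kF) with hZ
  have hZ2 : Z ∈ sector (fermiBall kF) 2 2 := doubleCommutator_mem_sector φ V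
  set s := lune kF k ×ˢ lune kF k
  set x : Momentum × Momentum → ℝ := fun i => ‖cre (i.1 - k) (ann i.2 Z)‖
  set y : Momentum × Momentum → ℝ := fun i =>
    ‖luneCoeff φ i.1‖ * ‖luneCoeff φ i.2‖ * ‖dressedPair V kF (i.1 + k - i.2) i.1‖
  have h1 : ‖Z‖ ^ 2 ≤ 4 * ∑ i ∈ s, x i * y i := by
    have h2 : ‖Z‖ ^ 2 = ‖inner ℂ Z Z‖ := by
      rw [inner_self_eq_norm_sq_to_K]; simp
    have h3 : inner ℂ Z Z = ∑ i ∈ s, (-4 * (luneCoeff φ i.1 * luneCoeff φ i.2)) *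
        inner ℂ (cre (i.1 - k) (ann i.2 Z)) (dressedPair V kF (i.1 + k - i.2) i.1) := by
      have h4 := congrArg (fun Φ => inner ℂ Z Φ) (hZ.trans (doubleCommutator_fermiState φ V))
      refine h4.trans ?_
      rw [inner_sum, Finset.sum_product]
      refine Finset.sum_congr rfl fun q _ => ?_
      rw [inner_sum]
      refine Finset.sum_congr rfl fun r _ => ?_
      rw [inner_smul_right, inner_cre_right, ← inner_cre_left]
    rw [h2, h3, Finset.mul_sum]
    refine (norm_sum_le _ _).trans (Finset.sum_le_sum fun i _ => ?_)
    rw [norm_mul, norm_mul, norm_mul]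
    have h4 := norm_inner_le_norm (𝕜 := ℂ) (cre (i.1 - k) (ann i.2 Z))
      (dressedPair V kF (i.1 + k - i.2) i.1)
    have h5 : ‖(-4 : ℂ)‖ = 4 := by simp
    rw [h5]
    calc _ ≤ 4 * (‖luneCoeff φ i.1‖ * ‖luneCoeff φ i.2‖) *
          (‖cre (i.1 - k) (ann i.2 Z)‖ * ‖dressedPair V kF (i.1 + k - i.2) i.1‖) := by gcongr
      _ = _ := by simp only [x, y]; ring
  -- Two particles times two holes.
  have h6 : ∑ i ∈ s, x i ^ 2 ≤ 4 * ‖Z‖ ^ 2 := by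
    rw [Finset.sum_product]
    refine (sum_norm_cre_ann_sq_le hZ2).trans (le_of_eq ?_)
    push_cast
    ring
  have h7 := Finset.sum_mul_sq_le_sq_mul_sq s x y
  rw [← Finset.sum_product (f := fun i => y i ^ 2)]
  change _ ≤ 64 * ∑ i ∈ s, y i ^ 2
  have hy : 0 ≤ ∑ i ∈ s, y i ^ 2 := Finset.sum_nonneg fun _ _ => sq_nonneg _
  have h8 : (‖Z‖ ^ 2) ^ 2 ≤ 64 * (∑ i ∈ s, y i ^ 2) * ‖Z‖ ^ 2 := by
    calc (‖Z‖ ^ 2) ^ 2 ≤ (4 * ∑ i ∈ s, x i * y i) ^ 2 := by gcongr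
      _ = 16 * (∑ i ∈ s, x i * y i) ^ 2 := by ring
      _ ≤ 16 * ((∑ i ∈ s, x i ^ 2) * ∑ i ∈ s, y i ^ 2) := by gcongr
      _ ≤ 16 * ((4 * ‖Z‖ ^ 2) * ∑ i ∈ s, y i ^ 2) := by gcongr
      _ = _ := by ring
  rcases eq_or_ne ‖Z‖ 0 with hz | hz
  · rw [hz]; nlinarith
  · have : 0 < ‖Z‖ ^ 2 := by positivity
    nlinarith

theorem norm_dressedPair_sq_le {l : Momentum} (q : lune kF l) :
    ‖dressedPair V kF l q‖ ^ 2 ≤ ‖(EOp kF V l - hOp kF l) (basisVec kF l q)‖ ^ 2 := by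
  rw [dressedPair, dif_pos q.2, dressedCre]
  simpa [norm_fermiState] using
    norm_bCreGen_sq_le ((EOp kF V l - hOp kF l) (basisVec kF l q)) (fermiState_mem_sector kF)

end NormBounds

end Plasmon

namespace Plasmon

/-! ### Lattice points -/

theorem normSq_nonneg (p : Momentum) : 0 ≤ normSq p := Finset.sum_nonneg fun _ _ => sq_nonneg _

theorem len_nonneg (p : Momentum) : 0 ≤ len p := Real.sqrt_nonneg _

theorem len_sq (p : Momentum) : len p ^ 2 = normSq p := Real.sq_sqrt (normSq_nonneg p)

theorem normSq_neg (p : Momentum) : normSq (-p) = normSq p := by simp [normSq]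

theorem normSq_add (p q : Momentum) :
    normSq (p + q) = normSq p + 2 * ∑ i, (p i : ℝ) * q i + normSq q := by
  simp only [normSq, Finset.mul_sum, ← Finset.sum_add_distrib]
  refine Finset.sum_congr rfl fun i _ => ?_
  push_cast [Pi.add_apply]
  ring

theorem normSq_add_add_normSq_sub (p q : Momentum) :
    normSq (p + q) + normSq (p - q) = 2 * normSq p + 2 * normSq q := by
  rw [sub_eq_add_neg, normSq_add, normSq_add, normSq_neg]
  simp only [Pi.neg_apply, Int.cast_neg, mul_neg, Finset.sum_neg_distrib]
  ring

theorem one_le_normSq {p : Momentum} (hp : p ≠ 0) : 1 ≤ normSq p := by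
  obtain ⟨i, hi⟩ := Function.ne_iff.mp hp
  have h1 : (1 : ℝ) ≤ (p i : ℝ) ^ 2 := by
    have : (1 : ℤ) ≤ (p i) ^ 2 := by
      have hi' : p i ≠ 0 := hi
      have : 0 < (p i) ^ 2 := by positivity
      omega
    exact_mod_cast this
  exact h1.trans (Finset.single_le_sum (f := fun j => (p j : ℝ) ^ 2) (fun j _ => sq_nonneg _)
    (Finset.mem_univ i))

theorem one_le_len {p : Momentum} (hp : p ≠ 0) : 1 ≤ len p :=
  Real.one_le_sqrt.mpr (one_le_normSq hp)

section

variable {kF : ℝ} {k p q r : Momentum}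

theorem mem_fermiBall_iff_normSq_le (hkF : 0 ≤ kF) : p ∈ fermiBall kF ↔ normSq p ≤ kF ^ 2 := by
  rw [mem_fermiBall, len, Real.sqrt_le_left hkF]

theorem normSq_sub_le_of_mem_lune (hkF : 0 ≤ kF) (hp : p ∈ lune kF k) :
    normSq (p - k) ≤ kF ^ 2 :=
  (mem_fermiBall_iff_normSq_le hkF).mp (sub_mem_fermiBall_of_mem_lune hp)

theorem lt_normSq_of_mem_lune (hkF : 0 ≤ kF) (hp : p ∈ lune kF k) : kF ^ 2 < normSq p := by
  have := notMem_fermiBall_of_mem_lune hp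
  rwa [mem_fermiBall_iff_normSq_le hkF, not_le] at this

theorem excEnergy_pos (hkF : 0 ≤ kF) (hp : p ∈ lune kF k) : 0 < excEnergy k p := by
  have h1 := normSq_sub_le_of_mem_lune hkF hp
  have h2 := lt_normSq_of_mem_lune hkF hp
  unfold excEnergy
  linarith

theorem excEnergy_le (hkF : 0 ≤ kF) (hk : len k ≤ kF) (hp : p ∈ lune kF k) :
    excEnergy k p ≤ 2 * kF * len k := by
  have h1 := normSq_sub_le_of_mem_lune hkF hp
  have h2 := normSq_add (p - k) k
  rw [sub_add_cancel] at h2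
  have h3 : ∑ i, ((p - k) i : ℝ) * k i ≤ kF * len k := by
    refine abs_le_of_sq_le_sq' ?_ (mul_nonneg hkF (len_nonneg k)) |>.2
    refine (Finset.sum_mul_sq_le_sq_mul_sq _ _ _).trans ?_
    rw [mul_pow, len_sq]
    exact mul_le_mul_of_nonneg_right h1 (normSq_nonneg k)
  have h4 : normSq k ≤ kF * len k := by
    rw [← len_sq, sq]
    exact mul_le_mul_of_nonneg_right hk (len_nonneg k)
  have h5 := mul_nonneg hkF (len_nonneg k)
  unfold excEnergy
  linarith

theorem mem_lune_transfer (hq : q ∈ lune kF k) (hr : r ∈ lune kF k) :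
    q ∈ lune kF (q + k - r) := by
  rw [mem_lune_iff, show q - (q + k - r) = r - k by abel]
  exact ⟨sub_mem_fermiBall_of_mem_lune hr, notMem_fermiBall_of_mem_lune hq⟩

/-- The difference of the two sides is `(|r|² - |q-k|²)/2`, which is positive because `r` lies
outside and `q - k` inside the ball. -/
theorem excEnergy_transfer_le (hkF : 0 ≤ kF) (hq : q ∈ lune kF k) (hr : r ∈ lune kF k) :
    excEnergy (q + k - r) q ≤ excEnergy k q + excEnergy k r := by
  have h1 := normSq_sub_le_of_mem_lune hkF hq
  have h2 := lt_normSq_of_mem_lune hkF hr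
  unfold excEnergy
  rw [show q - (q + k - r) = r - k by abel]
  linarith

theorem neg_mem_fermiBall : -p ∈ fermiBall kF ↔ p ∈ fermiBall kF := by
  rw [mem_fermiBall, mem_fermiBall, len, len, normSq_neg]

theorem sum_fermiBall_comm_neg (f : Momentum → ℝ) :
    ∑ p ∈ fermiBall kF, f (-p) = ∑ p ∈ fermiBall kF, f p :=
  Finset.sum_nbij' (fun p => -p) (fun p => -p) (fun _ hp => neg_mem_fermiBall.mpr hp)
    (fun _ hp => neg_mem_fermiBall.mpr hp) (fun p _ => neg_neg p) (fun p _ => neg_neg p)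
    (fun _ _ => rfl)

/-- An exact identity: the lune is the shifted ball without its overlap with the ball. The overlap
contributes zero, and on the whole shifted ball reflection and the parallelogram law give the sum.
-/
theorem sum_excEnergy_lune (kF : ℝ) (k : Momentum) :
    ∑ p ∈ lune kF k, excEnergy k p = (fermiBall kF).card * normSq k / 2 := by
  set S := (fermiBall kF).image fun q => q + k with hS
  have memS : ∀ p, p ∈ S ↔ p - k ∈ fermiBall kF := fun p => by
    rw [hS, Finset.mem_image]
    constructor
    · rintro ⟨q, hq, rfl⟩; simpa using hq
    · intro h; exact ⟨_, h, by simp⟩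
  have h1 : ∑ p ∈ S, excEnergy k p = (fermiBall kF).card * normSq k / 2 := by
    rw [hS, Finset.sum_image fun x _ y _ hxy => add_left_injective k hxy]
    have h2 : ∑ q ∈ fermiBall kF, excEnergy k (q + k) =
        ∑ q ∈ fermiBall kF, (normSq (q - k) - normSq q) / 2 := by
      rw [← sum_fermiBall_comm_neg]
      refine Finset.sum_congr rfl fun q _ => ?_
      rw [excEnergy, add_sub_cancel_right, normSq_neg, show -q + k = -(q - k) by abel, normSq_neg]
    have h3 : ∑ q ∈ fermiBall kF, excEnergy k (q + k) +
        ∑ q ∈ fermiBall kF, (normSq (q - k) - normSq q) / 2 =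
        (fermiBall kF).card * normSq k := by
      rw [← Finset.sum_add_distrib, ← nsmul_eq_mul, ← Finset.sum_const]
      refine Finset.sum_congr rfl fun q _ => ?_
      have := normSq_add_add_normSq_sub q k
      rw [excEnergy, add_sub_cancel_right]
      linarith
    linarith
  -- The reflection `p ↦ k - p` preserves the overlap and reverses the sign of the energy; at a
  -- fixed point the energy is zero.
  have h4 : ∑ p ∈ S.filter (· ∈ fermiBall kF), excEnergy k p = 0 := by
    refine Finset.sum_involution (fun p _ => k - p) (fun p _ => ?_) (fun p _ hp hkp => hp ?_)
      (fun p hp => ?_) (fun p _ => by abel)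
    · rw [excEnergy, excEnergy, show k - p - k = -p by abel, normSq_neg,
        show k - p = -(p - k) by abel, normSq_neg]
      ring
    · rw [excEnergy, show p - k = -(k - p) by abel, hkp, normSq_neg]
      ring
    · rw [Finset.mem_filter, memS] at hp ⊢
      rw [show k - p - k = -p by abel, neg_mem_fermiBall, show k - p = -(p - k) by abel,
        neg_mem_fermiBall]
      exact ⟨hp.2, hp.1⟩
  have h5 : lune kF k = S.filter fun p => ¬ p ∈ fermiBall kF := by
    ext p
    rw [mem_lune_iff, Finset.mem_filter, memS]
  rw [h5, ← h1, ← Finset.sum_filter_add_sum_filter_not S (· ∈ fermiBall kF), h4, zero_add]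

/-- The lattice points of the cube of half side `n`. -/
noncomputable def cube (n : ℕ) : Finset Momentum := Fintype.piFinset fun _ : Fin 3 => Finset.Icc (-(n : ℤ)) n

theorem mem_cube {n : ℕ} : p ∈ cube n ↔ ∀ i, |p i| ≤ n := by
  simp [cube, abs_le]

theorem card_cube (n : ℕ) : (cube n).card = (2 * n + 1) ^ 3 := by
  have : ((n : ℤ) + 1 - -n).toNat = 2 * n + 1 := by omega
  rw [cube, Fintype.card_piFinset_const, Int.card_Icc, this]

theorem cube_subset {m n : ℕ} (h : m ≤ n) : cube m ⊆ cube n := fun p hp =>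
  mem_cube.mpr fun i => (mem_cube.mp hp i).trans (by exact_mod_cast h)

/-- The cube of half side `⌊k_F/2⌋` fits in the ball, since `3 (k_F/2)² ≤ k_F²`. -/
theorem le_card_fermiBall (hkF : 2 ≤ kF) : kF ^ 3 / 8 ≤ (fermiBall kF).card := by
  have h1 : cube ⌊kF / 2⌋₊ ⊆ fermiBall kF := fun p hp => by
    rw [mem_fermiBall_iff_normSq_le (by linarith)]
    have h2 : ∀ i, (p i : ℝ) ^ 2 ≤ (kF / 2) ^ 2 := fun i => by
      rw [← sq_abs]
      have h3 : ((|p i| : ℤ) : ℝ) ≤ ((⌊kF / 2⌋₊ : ℤ) : ℝ) := by exact_mod_cast mem_cube.mp hp i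
      have h4 : (⌊kF / 2⌋₊ : ℝ) ≤ kF / 2 := Nat.floor_le (by linarith)
      push_cast at h3
      have h5 := h3.trans h4
      gcongr
    calc normSq p ≤ ∑ _i : Fin 3, (kF / 2) ^ 2 := Finset.sum_le_sum fun i _ => h2 i
      _ ≤ kF ^ 2 := by simp; nlinarith [sq_nonneg kF]
  have h3 : ((cube ⌊kF / 2⌋₊).card : ℝ) ≤ (fermiBall kF).card := by
    exact_mod_cast Finset.card_le_card h1
  refine le_trans ?_ h3
  rw [card_cube]
  push_cast
  have h4 := Nat.lt_floor_add_one (kF / 2)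
  have h5 : kF / 2 ≤ 2 * (⌊kF / 2⌋₊ : ℝ) + 1 := by linarith
  calc kF ^ 3 / 8 = (kF / 2) ^ 3 := by ring
    _ ≤ _ := by gcongr

theorem sum_cube_inv_normSq_le (n : ℕ) : ∑ l ∈ cube n, (normSq l)⁻¹ ≤ 26 * n := by
  induction n with
  | zero =>
    have : cube 0 = {0} := by
      ext p
      rw [mem_cube, Finset.mem_singleton]
      constructor
      · intro h; funext i; simpa using h i
      · rintro rfl; simp
    -- The origin contributes nothing because `0⁻¹ = 0`.
    simp [this, normSq]
  | succ n ih =>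
    rw [← Finset.sum_sdiff (cube_subset (Nat.le_succ n))]
    have h1 : ∀ l ∈ cube (n + 1) \ cube n, (normSq l)⁻¹ ≤ (((n : ℝ) + 1) ^ 2)⁻¹ := fun l hl => by
      rw [Finset.mem_sdiff, mem_cube, mem_cube] at hl
      obtain ⟨i, hi⟩ := not_forall.mp hl.2
      have h2 : (n : ℤ) + 1 ≤ |l i| := by omega
      have h3 : (n : ℝ) + 1 ≤ |(l i : ℝ)| := by exact_mod_cast h2
      have h4 : ((n : ℝ) + 1) ^ 2 ≤ normSq l := by
        refine le_trans ?_ (Finset.single_le_sum (f := fun j => (l j : ℝ) ^ 2)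
          (fun j _ => sq_nonneg _) (Finset.mem_univ i))
        rw [← sq_abs (l i : ℝ)]
        gcongr
      gcongr
    -- The shell has `(2n+3)³ - (2n+1)³ = 24n² + 48n + 26` points, so each shell contributes at most
    -- `26` to the sum.
    have h5 : ((cube (n + 1) \ cube n).card : ℝ) ≤ 26 * ((n : ℝ) + 1) ^ 2 := by
      rw [Finset.card_sdiff_of_subset (cube_subset (Nat.le_succ n)), Nat.cast_sub
        (Finset.card_le_card (cube_subset (Nat.le_succ n))), card_cube, card_cube]
      push_cast
      nlinarith [(n.cast_nonneg : (0 : ℝ) ≤ n)]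
    have h6 : ∑ l ∈ cube (n + 1) \ cube n, (normSq l)⁻¹ ≤ 26 := by
      calc _ ≤ ∑ _l ∈ cube (n + 1) \ cube n, (((n : ℝ) + 1) ^ 2)⁻¹ := Finset.sum_le_sum h1
        _ = (cube (n + 1) \ cube n).card * (((n : ℝ) + 1) ^ 2)⁻¹ := by
          rw [Finset.sum_const, nsmul_eq_mul]
        _ ≤ 26 * ((n : ℝ) + 1) ^ 2 * (((n : ℝ) + 1) ^ 2)⁻¹ := by gcongr
        _ = 26 := by field_simp
    push_cast
    linarith

/-- For fixed `q` the transfers are distinct. Since `l = (q - k) - (r - k) + k`, their coordinates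
are at most `3 k_F` in absolute value. -/
theorem sum_lune_inv_normSq_transfer_le (hkF : 0 ≤ kF) (hk : len k ≤ kF) (hq : q ∈ lune kF k) :
    ∑ r ∈ lune kF k, (normSq (q + k - r))⁻¹ ≤ 78 * kF := by
  have h1 : (lune kF k).image (fun r => q + k - r) ⊆ cube ⌊3 * kF⌋₊ := fun l hl => by
    obtain ⟨r, hr, rfl⟩ := Finset.mem_image.mp hl
    refine mem_cube.mpr fun i => ?_
    have h2 := abs_le.mp ((abs_le_len (q - k) i).trans (mem_lune.mp hq).1)
    have h3 := abs_le.mp ((abs_le_len (r - k) i).trans (mem_lune.mp hr).1)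
    have h4 := abs_le.mp ((abs_le_len k i).trans hk)
    have h5 : |((q + k - r) i : ℝ)| ≤ 3 * kF := by
      simp only [Pi.add_apply, Pi.sub_apply, Int.cast_add, Int.cast_sub] at h2 h3 ⊢
      rw [abs_le]
      constructor <;> linarith
    have h6 : ((|(q + k - r) i|.toNat : ℕ) : ℝ) ≤ 3 * kF := by
      have : ((|(q + k - r) i|.toNat : ℕ) : ℤ) = |(q + k - r) i| :=
        Int.toNat_of_nonneg (abs_nonneg _)
      have h7 : ((|(q + k - r) i|.toNat : ℕ) : ℝ) = ((|(q + k - r) i| : ℤ) : ℝ) := by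
        exact_mod_cast this
      rw [h7]
      push_cast
      exact h5
    have h8 := Nat.le_floor h6
    omega
  rw [← Finset.sum_image (f := fun l => (normSq l)⁻¹) (g := fun r => q + k - r)
    fun x _ y _ hxy => sub_right_injective hxy]
  calc _ ≤ ∑ l ∈ cube ⌊3 * kF⌋₊, (normSq l)⁻¹ :=
        Finset.sum_le_sum_of_subset_of_nonneg h1 fun l _ _ => inv_nonneg.mpr (normSq_nonneg l)
    _ ≤ 26 * (⌊3 * kF⌋₊ : ℝ) := sum_cube_inv_normSq_le _
    _ ≤ 26 * (3 * kF) := by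
      gcongr
      exact Nat.floor_le (by linarith)
    _ = 78 * kF := by ring

end

end Plasmon

namespace Plasmon

/-! ### The one-body operators -/

section OneBody

variable {kF : ℝ} {k : Momentum} {V : Momentum → ℝ}

/-- The diagonal operator on `ℓ²(L_k)` with real entries `d`. -/
noncomputable def diagOp (kF : ℝ) (k : Momentum) (d : Momentum → ℝ) :
    LuneSpace kF k →L[ℂ] LuneSpace kF k :=
  Matrix.toEuclideanCLM (𝕜 := ℂ) (Matrix.diagonal fun p : lune kF k => (d p : ℂ))

theorem diagOp_apply (d : Momentum → ℝ) (x : LuneSpace kF k) (p : lune kF k) :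
    diagOp kF k d x p = (d p : ℂ) * x p := by
  rw [diagOp]
  simp [Matrix.mulVec_diagonal]

theorem diagOp_mul (d e : Momentum → ℝ) :
    diagOp kF k d * diagOp kF k e = diagOp kF k fun p => d p * e p := by
  rw [diagOp, diagOp, diagOp, ← map_mul, Matrix.diagonal_mul_diagonal]
  simp

theorem star_diagOp (d : Momentum → ℝ) : star (diagOp kF k d) = diagOp kF k d := by
  rw [diagOp, ← map_star, Matrix.star_eq_conjTranspose, Matrix.diagonal_conjTranspose]
  congr 2
  funext p
  simp

theorem diagOp_congr {d e : Momentum → ℝ} (h : ∀ p ∈ lune kF k, d p = e p) :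
    diagOp kF k d = diagOp kF k e := by
  unfold diagOp
  congr 2
  funext p
  rw [h p p.2]

theorem diagOp_nonneg {d : Momentum → ℝ} (hd : ∀ p ∈ lune kF k, 0 ≤ d p) :
    0 ≤ diagOp kF k d := by
  have : diagOp kF k d = star (diagOp kF k fun p => √(d p)) * diagOp kF k fun p => √(d p) := by
    rw [star_diagOp, diagOp_mul]
    exact diagOp_congr fun p hp => (Real.mul_self_sqrt (hd p hp)).symm
  rw [this]
  exact star_mul_self_nonneg _

theorem sqrt_diagOp {d : Momentum → ℝ} (hd : ∀ p ∈ lune kF k, 0 ≤ d p) :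
    CFC.sqrt (diagOp kF k d) = diagOp kF k fun p => √(d p) := by
  refine CFC.sqrt_unique ?_ (diagOp_nonneg fun p _ => Real.sqrt_nonneg _)
  rw [diagOp_mul]
  exact diagOp_congr fun p hp => Real.mul_self_sqrt (hd p hp)

theorem hOp_eq_diagOp : hOp kF k = diagOp kF k (excEnergy k) := rfl

/-- The coupling constant `√(V̂_k / (2 (2π)³))`. -/
noncomputable def coupling (V : Momentum → ℝ) (k : Momentum) : ℝ :=
  Real.sqrt (V k / (2 * (2 * Real.pi) ^ 3))

theorem vVec_apply (p : lune kF k) : vVec kF V k p = (coupling V k : ℂ) := by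
  have h : ∑ p, basisVec kF k p = WithLp.toLp 2 fun _ => (1 : ℂ) := by
    conv_rhs => rw [← sum_basisVec (WithLp.toLp 2 fun _ => (1 : ℂ))]
    simp
  rw [vVec, h]
  simp [coupling]

/-- The vector `h_k^{1/2} v_k`. -/
noncomputable def wVec (kF : ℝ) (V : Momentum → ℝ) (k : Momentum) : LuneSpace kF k :=
  diagOp kF k (fun p => √(excEnergy k p)) (vVec kF V k)

theorem wVec_apply (p : lune kF k) :
    wVec kF V k p = ((√(excEnergy k p) * coupling V k : ℝ) : ℂ) := by
  rw [wVec, diagOp_apply, vVec_apply]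
  push_cast
  rfl

/-- This exhibits `Ẽ_k²` as `h_k²` plus a rank-one operator, the form on which all spectral
information below rests. -/
theorem EOp_argument_eq (hkF : 0 ≤ kF) :
    CFC.sqrt (hOp kF k) *
      (hOp kF k + (2 : ℂ) • InnerProductSpace.rankOne ℂ (vVec kF V k) (vVec kF V k)) *
      CFC.sqrt (hOp kF k) =
    hOp kF k * hOp kF k +
      (2 : ℂ) • InnerProductSpace.rankOne ℂ (wVec kF V k) (wVec kF V k) := by
  have hd : ∀ p ∈ lune kF k, 0 ≤ excEnergy k p := fun p hp => (excEnergy_pos hkF hp).le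
  set s := diagOp kF k fun p => √(excEnergy k p) with hs
  have h1 : s * hOp kF k * s = hOp kF k * hOp kF k := by
    rw [hs, hOp_eq_diagOp, diagOp_mul, diagOp_mul, diagOp_mul]
    refine diagOp_congr fun p hp => ?_
    have := Real.mul_self_sqrt (hd p hp)
    calc _ = excEnergy k p * (√(excEnergy k p) * √(excEnergy k p)) := by ring
      _ = _ := by rw [this]
  have h2 : s * InnerProductSpace.rankOne ℂ (vVec kF V k) (vVec kF V k) * s =
      InnerProductSpace.rankOne ℂ (wVec kF V k) (wVec kF V k) := by
    refine ContinuousLinearMap.ext fun x => ?_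
    have h3 : inner ℂ (vVec kF V k) (s x) = inner ℂ (wVec kF V k) x := by
      have h := ContinuousLinearMap.adjoint_inner_left s x (vVec kF V k)
      rw [← ContinuousLinearMap.star_eq_adjoint, hs, star_diagOp] at h
      exact h.symm
    change s (InnerProductSpace.rankOne ℂ (vVec kF V k) (vVec kF V k) (s x)) = _
    rw [InnerProductSpace.rankOne_apply, InnerProductSpace.rankOne_apply, map_smul, h3]
    rfl
  have h4 : CFC.sqrt (hOp kF k) = s := sqrt_diagOp hd
  rw [h4, mul_add, add_mul, h1, mul_smul_comm, smul_mul_assoc, h2]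

theorem hOp_nonneg (hkF : 0 ≤ kF) : 0 ≤ hOp kF k :=
  diagOp_nonneg fun _ hp => (excEnergy_pos hkF hp).le

theorem hOp_mul_self_nonneg : 0 ≤ hOp kF k * hOp kF k := by
  have h1 : star (hOp kF k) = hOp kF k := star_diagOp _
  have h2 := star_mul_self_nonneg (hOp kF k)
  rwa [h1] at h2

theorem two_rankOne_nonneg (x : LuneSpace kF k) :
    0 ≤ (2 : ℂ) • InnerProductSpace.rankOne ℂ x x := by
  have h : 0 ≤ InnerProductSpace.rankOne ℂ x x :=
    (ContinuousLinearMap.nonneg_iff_isPositive _).mpr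
      (InnerProductSpace.isPositive_rankOne_self x)
  rw [two_smul]
  exact add_nonneg h h

theorem EOp_eq (hkF : 0 ≤ kF) : EOp kF V k = CFC.sqrt (hOp kF k * hOp kF k +
      (2 : ℂ) • InnerProductSpace.rankOne ℂ (wVec kF V k) (wVec kF V k)) := by
  rw [EOp, EOp_argument_eq hkF]

theorem EOp_nonneg : 0 ≤ EOp kF V k := CFC.sqrt_nonneg _

theorem EOp_mul_self (hkF : 0 ≤ kF) : EOp kF V k * EOp kF V k = hOp kF k * hOp kF k +
      (2 : ℂ) • InnerProductSpace.rankOne ℂ (wVec kF V k) (wVec kF V k) := by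
  rw [EOp_eq hkF]
  exact CFC.sqrt_mul_sqrt_self _ (add_nonneg hOp_mul_self_nonneg (two_rankOne_nonneg _))

/-- Operator monotonicity of the square root, applied to `h_k² ≤ Ẽ_k²`. -/
theorem hOp_le_EOp (hkF : 0 ≤ kF) : hOp kF k ≤ EOp kF V k := by
  have h1 : CFC.sqrt (hOp kF k * hOp kF k) = hOp kF k := CFC.sqrt_unique rfl (hOp_nonneg hkF)
  rw [EOp_eq hkF]
  conv_lhs => rw [← h1]
  exact CFC.sqrt_le_sqrt _ _ (le_add_of_nonneg_right (two_rankOne_nonneg _))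

theorem EOp_isSymmetric (x y : LuneSpace kF k) :
    inner ℂ (EOp kF V k x) y = inner ℂ x (EOp kF V k y) :=
  ((ContinuousLinearMap.nonneg_iff_isPositive _).mp EOp_nonneg).isSymmetric x y

theorem EOp_EOp_apply (hkF : 0 ≤ kF) (x : LuneSpace kF k) (p : lune kF k) :
    EOp kF V k (EOp kF V k x) p = (excEnergy k p : ℂ) ^ 2 * x p +
      2 * inner ℂ (wVec kF V k) x * wVec kF V k p := by
  have h := congrArg (fun T : LuneSpace kF k →L[ℂ] LuneSpace kF k => T x p)
    (EOp_mul_self (V := V) (k := k) hkF)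
  change EOp kF V k (EOp kF V k x) p = (hOp kF k (hOp kF k x)) p +
    (2 : ℂ) * (InnerProductSpace.rankOne ℂ (wVec kF V k) (wVec kF V k) x) p at h
  rw [h, hOp_apply, hOp_apply, InnerProductSpace.rankOne_apply, PiLp.smul_apply, smul_eq_mul]
  ring

theorem hOp_basisVec (q : lune kF k) :
    hOp kF k (basisVec kF k q) = (excEnergy k q : ℂ) • basisVec kF k q := by
  ext p
  rw [hOp_apply, PiLp.smul_apply, smul_eq_mul, basisVec]
  by_cases h : p = q
  · rw [h]
  · simp [h]

theorem inner_basisVec (q : lune kF k) (x : LuneSpace kF k) :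
    inner ℂ (basisVec kF k q) x = x q := by
  rw [basisVec, EuclideanSpace.inner_single_left]; simp

/-- On expanding the square, `‖Ẽ e_q‖²` is a diagonal entry of `Ẽ²` and thus explicit, while `Ẽ ≥ h`
bounds the cross term. The terms `λ²` cancel, and no formula for `Ẽ` itself is needed. -/
theorem norm_EOp_sub_hOp_basisVec_sq_le (hkF : 0 ≤ kF) (q : lune kF k) :
    ‖(EOp kF V k - hOp kF k) (basisVec kF k q)‖ ^ 2 ≤
      2 * (excEnergy k q * coupling V k ^ 2) := by
  set e := basisVec kF k q with he
  have hl := (excEnergy_pos hkF q.2).le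
  have he1 : ‖e‖ = 1 := by simp [he, basisVec]
  have heq : e q = 1 := by simp [he, basisVec]
  have h1 : ‖EOp kF V k e‖ ^ 2 =
      excEnergy k q ^ 2 + 2 * (excEnergy k q * coupling V k ^ 2) := by
    have h2 : ((‖EOp kF V k e‖ ^ 2 : ℝ) : ℂ) =
        ((excEnergy k q ^ 2 + 2 * (excEnergy k q * coupling V k ^ 2) : ℝ) : ℂ) := by
      have h3 : ((‖EOp kF V k e‖ ^ 2 : ℝ) : ℂ) = inner ℂ (EOp kF V k e) (EOp kF V k e) := by
        rw [inner_self_eq_norm_sq_to_K]; norm_cast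
      rw [h3, EOp_isSymmetric, inner_basisVec, EOp_EOp_apply hkF, heq, ← inner_conj_symm,
        inner_basisVec, wVec_apply, Complex.conj_ofReal]
      have h4 : (√(excEnergy k q) * coupling V k) * (√(excEnergy k q) * coupling V k) =
          excEnergy k q * coupling V k ^ 2 := by
        calc _ = (√(excEnergy k q) * √(excEnergy k q)) * coupling V k ^ 2 := by ring
          _ = _ := by rw [Real.mul_self_sqrt hl]
      rw [← h4]
      push_cast
      ring
    exact_mod_cast h2
  have h5 : excEnergy k q ≤ (inner ℂ e (EOp kF V k e)).re := by
    have h6 := ((ContinuousLinearMap.le_def _ _).mp (hOp_le_EOp (V := V) (k := k) hkF)).re_inner_nonneg_right e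
    rw [sub_apply, inner_sub_right, hOp_basisVec, inner_smul_right, inner_self_eq_norm_sq_to_K,
      he1] at h6
    simpa using h6
  have h7 : hOp kF k e = (excEnergy k q : ℂ) • e := hOp_basisVec q
  rw [sub_apply, @norm_sub_sq ℂ, h1, h7, inner_smul_right, norm_smul, he1, EOp_isSymmetric]
  simp only [RCLike.re_to_complex, Complex.re_ofReal_mul, Complex.norm_real, Real.norm_eq_abs,
    mul_one, sq_abs]
  nlinarith

/-! ### The greatest eigenvalue -/

theorem norm_sq_wVec (hkF : 0 ≤ kF) : ‖wVec kF V k‖ ^ 2 =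
    coupling V k ^ 2 * ∑ p ∈ lune kF k, excEnergy k p := by
  rw [EuclideanSpace.norm_sq_eq, Finset.mul_sum, ← Finset.sum_coe_sort (lune kF k)]
  refine Finset.sum_congr rfl fun p _ => ?_
  rw [wVec_apply, Complex.norm_real, Real.norm_eq_abs, sq_abs, mul_pow,
    Real.sq_sqrt (excEnergy_pos hkF p.2).le, mul_comm]

/-- Applying the form bound twice through the square root of the positive operator turns it into a
norm bound. -/
theorem norm_EOp_apply_le {c : ℝ} (hc : 0 ≤ c)
    (h : ∀ x : LuneSpace kF k, (inner ℂ (EOp kF V k x) x).re ≤ c * ‖x‖ ^ 2)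
    (x : LuneSpace kF k) : ‖EOp kF V k x‖ ^ 2 ≤ c ^ 2 * ‖x‖ ^ 2 := by
  set S := CFC.sqrt (EOp kF V k) with hS
  have hSS : S * S = EOp kF V k := CFC.sqrt_mul_sqrt_self _ EOp_nonneg
  have hS0 : 0 ≤ S := CFC.sqrt_nonneg (EOp kF V k)
  have hsymm : ∀ x y, inner ℂ (S x) y = inner ℂ x (S y) :=
    ((ContinuousLinearMap.nonneg_iff_isPositive S).mp hS0).isSymmetric
  have h1 : ∀ x, EOp kF V k x = S (S x) := fun x => by rw [← hSS]; rfl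
  have h2 : ∀ x, ‖S x‖ ^ 2 ≤ c * ‖x‖ ^ 2 := fun x => by
    refine le_trans (le_of_eq ?_) (h x)
    rw [h1, hsymm]
    exact norm_sq_eq_re_inner (𝕜 := ℂ) _
  rw [h1]
  calc ‖S (S x)‖ ^ 2 ≤ c * ‖S x‖ ^ 2 := h2 _
    _ ≤ c * (c * ‖x‖ ^ 2) := by gcongr; exact h2 x
    _ = _ := by ring

/-- In finite dimension the supremum of the Rayleigh quotient is attained as an eigenvalue, and
every eigenvalue is a value of that quotient. -/
theorem exists_isGreatest_eigenvalues2E [Nontrivial (LuneSpace kF k)] :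
    ∃ ek : ℝ, 0 ≤ ek ∧ IsGreatest (eigenvalues2E kF V k) ek ∧
      ∀ x : LuneSpace kF k, (inner ℂ (EOp kF V k x) x).re ≤ ek / 2 * ‖x‖ ^ 2 := by
  set T := ((2 : ℂ) • EOp kF V k : LuneSpace kF k →L[ℂ] LuneSpace kF k) with hT
  have hTx : ∀ x y, inner ℂ (T x) y = 2 * inner ℂ (EOp kF V k x) y := fun x y => by
    rw [hT, smul_apply, inner_smul_left, map_ofNat]
  have hsymm : (T : LuneSpace kF k →ₗ[ℂ] LuneSpace kF k).IsSymmetric := fun x y => by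
    change inner ℂ (T x) y = inner ℂ x (T y)
    rw [hTx, EOp_isSymmetric, hT, smul_apply, inner_smul_right]
  set R : {x : LuneSpace kF k // x ≠ 0} → ℝ := fun x =>
    (inner ℂ (T x) (x : LuneSpace kF k)).re / ‖(x : LuneSpace kF k)‖ ^ 2 with hR
  have hbdd : BddAbove (Set.range R) := by
    refine ⟨‖T‖, ?_⟩
    rintro _ ⟨x, rfl⟩
    have hx : 0 < ‖(x : LuneSpace kF k)‖ := norm_pos_iff.mpr x.2
    rw [hR]
    simp only
    rw [div_le_iff₀ (by positivity)]
    refine (Complex.re_le_norm _).trans ((norm_inner_le_norm _ _).trans ?_)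
    have := T.le_opNorm (x : LuneSpace kF k)
    nlinarith
  have hle : ∀ x : {x : LuneSpace kF k // x ≠ 0}, R x ≤ ⨆ x, R x := fun x => le_ciSup hbdd x
  refine ⟨⨆ x, R x, ?_, ⟨?_, ?_⟩, ?_⟩
  · refine Real.iSup_nonneg fun x => div_nonneg ?_ (sq_nonneg _)
    rw [hTx]
    have := ((ContinuousLinearMap.nonneg_iff_isPositive _).mp
      (EOp_nonneg (V := V) (kF := kF) (k := k))).re_inner_nonneg_left (x : LuneSpace kF k)
    simpa using this
  · exact hsymm.hasEigenvalue_iSup_of_finiteDimensional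
  · rintro μ hμ
    obtain ⟨x, hx⟩ := Module.End.HasEigenvalue.exists_hasEigenvector hμ
    have hx0 : 0 < ‖x‖ := norm_pos_iff.mpr hx.2
    refine le_trans (le_of_eq ?_) (hle ⟨x, hx.2⟩)
    have h1 : T x = (μ : ℂ) • x := hx.apply_eq_smul
    simp only [hR]
    rw [h1, inner_smul_left, inner_self_eq_norm_sq_to_K, eq_div_iff (by positivity)]
    simp [← Complex.ofReal_pow]
  · intro x
    rcases eq_or_ne x 0 with rfl | hx
    · simp
    · have hx0 : 0 < ‖x‖ := norm_pos_iff.mpr hx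
      have h1 := hle ⟨x, hx⟩
      have h2 : R ⟨x, hx⟩ = 2 * (inner ℂ (EOp kF V k x) x).re / ‖x‖ ^ 2 := by
        simp only [hR]
        rw [hTx]; simp
      rw [h2, div_le_iff₀ (by positivity)] at h1
      linarith

/-- Test vector `w` itself: `‖Ẽ w‖² = ‖h w‖² + 2‖w‖⁴`, and the first term is dropped. -/
theorem two_mul_norm_wVec_sq_le (hkF : 0 ≤ kF) {c : ℝ}
    (h : ∀ x : LuneSpace kF k, ‖EOp kF V k x‖ ^ 2 ≤ c * ‖x‖ ^ 2) (hw : wVec kF V k ≠ 0) :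
    2 * ‖wVec kF V k‖ ^ 2 ≤ c := by
  set w := wVec kF V k with hwd
  have hw0 : 0 < ‖w‖ ^ 2 := by have := norm_pos_iff.mpr hw; positivity
  have h1 : ‖EOp kF V k w‖ ^ 2 = ‖hOp kF k w‖ ^ 2 + 2 * (‖w‖ ^ 2) ^ 2 := by
    have h0 : ∀ Φ : LuneSpace kF k, ((‖Φ‖ ^ 2 : ℝ) : ℂ) = inner ℂ Φ Φ := fun Φ => by
      rw [inner_self_eq_norm_sq_to_K]; norm_cast
    have h2 : EOp kF V k (EOp kF V k w) = hOp kF k (hOp kF k w) +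
        (2 * inner ℂ w w) • w := by
      ext p
      rw [EOp_EOp_apply hkF, PiLp.add_apply, hOp_apply, hOp_apply, PiLp.smul_apply, smul_eq_mul]
      ring
    have h3 : inner ℂ w (hOp kF k (hOp kF k w)) = inner ℂ (hOp kF k w) (hOp kF k w) :=
      (((ContinuousLinearMap.nonneg_iff_isPositive _).mp
        (hOp_nonneg (k := k) hkF)).isSymmetric w (hOp kF k w)).symm
    have h4 : ((‖EOp kF V k w‖ ^ 2 : ℝ) : ℂ) =
        ((‖hOp kF k w‖ ^ 2 + 2 * (‖w‖ ^ 2) ^ 2 : ℝ) : ℂ) := by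
      rw [h0, EOp_isSymmetric, h2, inner_add_right, h3, inner_smul_right, ← h0, ← h0]
      push_cast
      ring
    exact_mod_cast h4
  have h5 := h w
  rw [h1] at h5
  have h6 := sq_nonneg ‖hOp kF k w‖
  refine le_of_mul_le_mul_right ?_ hw0
  linarith

end OneBody

end Plasmon

namespace Plasmon

/-! ### The secular equation -/

section Secular

variable {kF : ℝ} {k : Momentum} {V : Momentum → ℝ} {μ L : ℝ} {φ : LuneSpace kF k}

theorem eigenvector_apply (hkF : 0 ≤ kF) (hμ : EOp kF V k (EOp kF V k φ) = (μ : ℂ) • φ)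
    (p : lune kF k) : ((μ - excEnergy k p ^ 2 : ℝ) : ℂ) * φ p =
      2 * inner ℂ (wVec kF V k) φ * wVec kF V k p := by
  have h := EOp_EOp_apply (V := V) hkF φ p
  rw [hμ, PiLp.smul_apply, smul_eq_mul] at h
  push_cast
  linear_combination h

/-- The gap gives `μ/2 ≤ μ - λ_p² ≤ μ`, so in `(μ - λ_p²) φ_p = 2⟨w,φ⟩ w_p` the eigenvector is
proportional to `w` up to a factor two. Normalization fixes the size of `⟨w,φ⟩`. -/
theorem norm_eigenvector_apply_sq_le (hkF : 0 ≤ kF)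
    (hμ : EOp kF V k (EOp kF V k φ) = (μ : ℂ) • φ) (hφ : ‖φ‖ = 1)
    (hL : ∀ p ∈ lune kF k, excEnergy k p ^ 2 ≤ L) (hLμ : 2 * L ≤ μ) (hμ0 : 0 < μ)
    (p : lune kF k) :
    ‖φ p‖ ^ 2 * ‖wVec kF V k‖ ^ 2 ≤ 4 * ‖wVec kF V k p‖ ^ 2 := by
  set a := ‖inner ℂ (wVec kF V k) φ‖ with ha
  have h1 : ∀ p : lune kF k,
      (μ - excEnergy k p ^ 2) * ‖φ p‖ = 2 * a * ‖wVec kF V k p‖ := fun p => by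
    have h2 := congrArg norm (eigenvector_apply hkF hμ p)
    have h3 : 0 ≤ μ - excEnergy k p ^ 2 := by linarith [hL p p.2]
    rw [norm_mul, norm_mul, norm_mul, Complex.norm_real, Real.norm_of_nonneg h3] at h2
    simpa using h2
  have h4 : 4 * a ^ 2 * ‖wVec kF V k‖ ^ 2 ≤ μ ^ 2 := by
    calc 4 * a ^ 2 * ‖wVec kF V k‖ ^ 2 = ∑ p, (2 * a * ‖wVec kF V k p‖) ^ 2 := by
          rw [EuclideanSpace.norm_sq_eq, Finset.mul_sum]
          exact Finset.sum_congr rfl fun p _ => by ring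
      _ ≤ ∑ p, (μ * ‖φ p‖) ^ 2 := by
          refine Finset.sum_le_sum fun p _ => ?_
          rw [← h1 p]
          have h3 : 0 ≤ μ - excEnergy k p ^ 2 := by linarith [hL p p.2]
          have h5 := sq_nonneg (excEnergy k p)
          gcongr
          linarith
      _ = μ ^ 2 * ‖φ‖ ^ 2 := by
          rw [EuclideanSpace.norm_sq_eq φ, Finset.mul_sum]
          exact Finset.sum_congr rfl fun p _ => by ring
      _ = μ ^ 2 := by rw [hφ]; ring
  have h6 : (μ / 2 * ‖φ p‖) ^ 2 ≤ (2 * a * ‖wVec kF V k p‖) ^ 2 := by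
    rw [← h1 p]
    have h3 := hL p p.2
    gcongr
    linarith
  have h7 : μ ^ 2 * (‖φ p‖ ^ 2 * ‖wVec kF V k‖ ^ 2) ≤ μ ^ 2 * (4 * ‖wVec kF V k p‖ ^ 2) := by
    calc _ = 4 * (μ / 2 * ‖φ p‖) ^ 2 * ‖wVec kF V k‖ ^ 2 := by ring
      _ ≤ 4 * (2 * a * ‖wVec kF V k p‖) ^ 2 * ‖wVec kF V k‖ ^ 2 := by gcongr
      _ = (4 * a ^ 2 * ‖wVec kF V k‖ ^ 2) * (4 * ‖wVec kF V k p‖ ^ 2) := by ring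
      _ ≤ _ := by gcongr
  exact le_of_mul_le_mul_left h7 (by positivity)

/-- Solving the eigenvalue equation for `φ_p` and pairing with `w` reproduces `⟨w,φ⟩`, which may be
cancelled: if it were zero, `φ` would vanish. -/
theorem secular_equation (hkF : 0 ≤ kF)
    (hμ : EOp kF V k (EOp kF V k φ) = (μ : ℂ) • φ) (hφ : φ ≠ 0)
    (hL : ∀ p ∈ lune kF k, excEnergy k p ^ 2 ≤ L) (hLμ : 2 * L ≤ μ) (hμ0 : 0 < μ) :
    2 * ∑ p ∈ lune kF k, coupling V k ^ 2 * excEnergy k p / (μ - excEnergy k p ^ 2) = 1 := by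
  have hpos : ∀ p : lune kF k, 0 < μ - excEnergy k p ^ 2 := fun p => by
    linarith [hL p p.2]
  set a := inner ℂ (wVec kF V k) φ with ha
  have h1 : ∀ p : lune kF k,
      φ p = 2 * a * wVec kF V k p / ((μ - excEnergy k p ^ 2 : ℝ) : ℂ) := fun p => by
    have h2 : ((μ - excEnergy k p ^ 2 : ℝ) : ℂ) ≠ 0 := by
      exact_mod_cast (hpos p).ne'
    rw [eq_div_iff h2, mul_comm, eigenvector_apply hkF hμ p]
  have ha0 : a ≠ 0 := by
    intro h0
    refine hφ (PiLp.ext fun p => ?_)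
    rw [h1, h0]; simp
  have h3 : a = a * ((2 * ∑ p ∈ lune kF k,
      coupling V k ^ 2 * excEnergy k p / (μ - excEnergy k p ^ 2) : ℝ) : ℂ) := by
    conv_lhs => rw [ha, PiLp.inner_apply]
    rw [← Finset.sum_coe_sort (lune kF k), Complex.ofReal_mul, Complex.ofReal_sum,
      Finset.mul_sum, Finset.mul_sum]
    refine Finset.sum_congr rfl fun p _ => ?_
    have h4 : √(excEnergy k p) * √(excEnergy k p) = excEnergy k p :=
      Real.mul_self_sqrt (excEnergy_pos hkF p.2).le
    rw [h1 p, wVec_apply]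
    have h5 : coupling V k ^ 2 * excEnergy k p =
        (√(excEnergy k p) * coupling V k) * (√(excEnergy k p) * coupling V k) := by
      calc _ = coupling V k ^ 2 * (√(excEnergy k p) * √(excEnergy k p)) := by rw [h4]
        _ = _ := by ring
    rw [h5, RCLike.inner_apply, Complex.conj_ofReal]
    push_cast
    ring
  have h6 := mul_left_cancel₀ ha0 ((mul_one a).trans h3)
  exact_mod_cast h6.symm

theorem vMoment_eq (n : ℕ) : vMoment kF V k n =
    ∑ p ∈ lune kF k, coupling V k ^ 2 * excEnergy k p ^ n := by
  have h1 : ∀ p : lune kF k,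
      (hOp kF k ^ n) (vVec kF V k) p = ((excEnergy k p ^ n * coupling V k : ℝ) : ℂ) := by
    induction n with
    | zero => intro p; simp [vVec_apply]
    | succ n ih =>
      intro p
      rw [pow_succ']
      change hOp kF k ((hOp kF k ^ n) (vVec kF V k)) p = _
      rw [hOp_apply, ih]
      push_cast
      ring
  rw [vMoment, PiLp.inner_apply, Complex.re_sum, ← Finset.sum_coe_sort (lune kF k)]
  refine Finset.sum_congr rfl fun p _ => ?_
  rw [h1, vVec_apply, RCLike.inner_apply, Complex.conj_ofReal, ← Complex.ofReal_mul,
    Complex.ofReal_re]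
  ring

/-- The secular equation yields `μ - 2W = ∑ w x · 2/(μ - x)`, which lies in `[0, 2L]`. Thus `μ` is
close to `2W`, and reinserting this as `2/(μ - x) ≈ 1/W` gives the next order. -/
theorem abs_sub_le_of_secular {ι : Type*} {s : Finset ι} {w x : ι → ℝ} {μ L : ℝ}
    (hw : ∀ i ∈ s, 0 ≤ w i) (hx0 : ∀ i ∈ s, 0 ≤ x i) (hx : ∀ i ∈ s, x i ≤ L)
    (hLμ : 2 * L ≤ μ) (hμ : 0 < μ) (hW : 0 < ∑ i ∈ s, w i) (hWμ : 2 * ∑ i ∈ s, w i ≤ μ)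
    (hsec : 2 * ∑ i ∈ s, w i / (μ - x i) = 1) :
    |4 * μ - (8 * ∑ i ∈ s, w i + 4 * ((∑ i ∈ s, w i * x i) / ∑ i ∈ s, w i))| ≤
      16 * L ^ 2 / μ := by
  set W := ∑ i ∈ s, w i with hWd
  have hd : ∀ i ∈ s, μ / 2 ≤ μ - x i := fun i hi => by linarith [hx i hi]
  have h1 : μ - 2 * W = ∑ i ∈ s, w i * x i * (2 / (μ - x i)) := by
    have h2 : μ = ∑ i ∈ s, 2 * μ * (w i / (μ - x i)) := by
      rw [← Finset.mul_sum]
      linear_combination (-μ) * hsec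
    conv_lhs => rw [h2]
    rw [hWd, Finset.mul_sum, ← Finset.sum_sub_distrib]
    refine Finset.sum_congr rfl fun i hi => ?_
    have : μ - x i ≠ 0 := by linarith [hd i hi]
    field_simp
    ring
  obtain ⟨i₀, hi₀⟩ : s.Nonempty := by
    by_contra h
    rw [Finset.not_nonempty_iff_eq_empty] at h
    simp [hWd, h] at hW
  have hL0 : 0 ≤ L := (hx0 i₀ hi₀).trans (hx i₀ hi₀)
  have h3 : μ - 2 * W ≤ 2 * L := by
    rw [h1]
    calc ∑ i ∈ s, w i * x i * (2 / (μ - x i)) ≤ ∑ i ∈ s, w i * (L * (2 / (μ / 2))) := by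
          refine Finset.sum_le_sum fun i hi => ?_
          rw [mul_assoc]
          have h4 := hw i hi
          have h5 := hx i hi
          have h6 := hd i hi
          have h7 := hx0 i hi
          have h8 : 0 ≤ 2 / (μ - x i) := div_nonneg zero_le_two (by linarith)
          gcongr
      _ = W * (L * 4 / μ) := by rw [← Finset.sum_mul]; ring
      _ ≤ (μ / 2) * (L * 4 / μ) := by gcongr; linarith
      _ = 2 * L := by field_simp; ring
  have h8 : 4 * μ - (8 * W + 4 * ((∑ i ∈ s, w i * x i) / W)) =
      4 * ∑ i ∈ s, w i * x i * (2 / (μ - x i) - 1 / W) := by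
    have h9 : ∑ i ∈ s, w i * x i * (2 / (μ - x i) - 1 / W) =
        (μ - 2 * W) - (∑ i ∈ s, w i * x i) / W := by
      rw [h1, Finset.sum_div, ← Finset.sum_sub_distrib]
      exact Finset.sum_congr rfl fun i _ => by ring
    rw [h9]; ring
  rw [h8, abs_mul, abs_of_pos (by norm_num : (0 : ℝ) < 4)]
  have h10 : |∑ i ∈ s, w i * x i * (2 / (μ - x i) - 1 / W)| ≤ 4 * L ^ 2 / μ := by
    refine (Finset.abs_sum_le_sum_abs _ _).trans ?_
    calc ∑ i ∈ s, |w i * x i * (2 / (μ - x i) - 1 / W)|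
        ≤ ∑ i ∈ s, w i * (L * (2 * L / (W * (μ / 2)))) := by
          refine Finset.sum_le_sum fun i hi => ?_
          have h4 := hw i hi
          have h5 := hx i hi
          have h6 := hd i hi
          have h7 := hx0 i hi
          have h11 : 0 < μ - x i := by linarith
          have h12 : 2 / (μ - x i) - 1 / W = (2 * W - μ + x i) / (W * (μ - x i)) := by
            field_simp
            ring
          have h13 : |2 / (μ - x i) - 1 / W| ≤ 2 * L / (W * (μ / 2)) := by
            rw [h12, abs_div, abs_of_pos (mul_pos hW h11)]
            -- Uses `0 ≤ μ - 2W ≤ 2L` together with `0 ≤ x i ≤ L`.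
            have h14 : |2 * W - μ + x i| ≤ 2 * L := by
              rw [abs_le]; constructor <;> linarith
            gcongr
          rw [abs_mul, abs_mul, abs_of_nonneg h4, abs_of_nonneg h7, mul_assoc]
          gcongr
      _ = W * (L * (2 * L / (W * (μ / 2)))) := by rw [← Finset.sum_mul]
      _ = 4 * L ^ 2 / μ := by field_simp; ring
  calc _ ≤ 4 * (4 * L ^ 2 / μ) := by gcongr
    _ = _ := by ring

theorem abs_sub_sqrt_le {a Y D : ℝ} (ha : 0 < a) (hY : 0 ≤ Y) (h : |a ^ 2 - Y| ≤ D) :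
    |a - √Y| ≤ D / a := by
  rw [le_div_iff₀ ha]
  refine le_trans ?_ h
  have h1 : a ^ 2 - Y = (a - √Y) * (a + √Y) := by
    have := Real.sq_sqrt hY
    linear_combination this
  rw [h1, abs_mul]
  have h2 : a ≤ |a + √Y| := by
    have := Real.sqrt_nonneg Y
    rw [abs_of_nonneg (by linarith)]
    linarith
  gcongr

end Secular

/-! ### The Coulomb potential -/

section Coulomb

variable {g kF : ℝ} {k : Momentum}

theorem coupling_coulomb_sq (hg : 0 < g) (l : Momentum) :
    coupling (coulomb g) l ^ 2 = g / (2 * (2 * Real.pi) ^ 3) * (normSq l)⁻¹ := by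
  have h1 : 0 ≤ coulomb g l / (2 * (2 * Real.pi) ^ 3) := by
    have := Real.pi_pos
    unfold coulomb
    positivity
  rw [coupling, Real.sq_sqrt h1, coulomb, len_sq]
  ring

theorem norm_sq_wVec_coulomb (hg : 0 < g) (hkF : 0 ≤ kF) (hk : k ≠ 0) :
    ‖wVec kF (coulomb g) k‖ ^ 2 = g / (4 * (2 * Real.pi) ^ 3) * (fermiBall kF).card := by
  have h1 : normSq k ≠ 0 := (lt_of_lt_of_le one_pos (one_le_normSq hk)).ne'
  have h2 := Real.pi_pos
  rw [norm_sq_wVec hkF, coupling_coulomb_sq hg, sum_excEnergy_lune]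
  field_simp
  ring

/-- The powers of `k_F` cancel: `1/(k_F²|k|)` from one coefficient of `φ`, `k_F|k|` from the
excitation energy, and `k_F` from the sum over transfers. The other coefficient is summed with `‖φ‖
= 1`. The constant is `64 · 128 · 4 · 78`. -/
theorem norm_doubleCommutator_coulomb_sq_le (hg : 0 < g) (hkF : 2 ≤ kF) (hk0 : k ≠ 0)
    (hk : len k ≤ kF) {φ : LuneSpace kF k} (hφ : ‖φ‖ = 1)
    (hκ : ∀ p, ‖luneCoeff φ p‖ ^ 2 ≤ 128 / (kF ^ 2 * len k)) :
    ‖doubleCommutator φ (coulomb g) (fermiState kF)‖ ^ 2 ≤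
      2555904 * (g / (2 * Real.pi) ^ 3) := by
  have hkF0 : 0 < kF := by linarith
  have hk1 : 0 < len k := lt_of_lt_of_le one_pos (one_le_len hk0)
  have hpi := Real.pi_pos
  have h1 : ∀ q ∈ lune kF k, ∀ r ∈ lune kF k,
      ‖dressedPair (coulomb g) kF (q + k - r) q‖ ^ 2 ≤
        4 * kF * len k * (g / (2 * Real.pi) ^ 3) * (normSq (q + k - r))⁻¹ := fun q hq r hr => by
    have h2 := (norm_dressedPair_sq_le (coulomb g) ⟨q, mem_lune_transfer hq hr⟩).trans
      (norm_EOp_sub_hOp_basisVec_sq_le hkF0.le _)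
    refine h2.trans ?_
    rw [coupling_coulomb_sq hg]
    have h3 : excEnergy (q + k - r) q ≤ 4 * kF * len k := by
      have := excEnergy_transfer_le hkF0.le hq hr
      linarith [excEnergy_le hkF0.le hk hq, excEnergy_le hkF0.le hk hr]
    have h4 := inv_nonneg.mpr (normSq_nonneg (q + k - r))
    calc _ = excEnergy (q + k - r) q * (g / (2 * Real.pi) ^ 3) * (normSq (q + k - r))⁻¹ := by
          field_simp
      _ ≤ _ := by gcongr
  refine (norm_doubleCommutator_fermiState_sq_le φ (coulomb g)).trans ?_
  have h5 : ∀ q ∈ lune kF k, ∑ r ∈ lune kF k,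
      (‖luneCoeff φ q‖ * ‖luneCoeff φ r‖ * ‖dressedPair (coulomb g) kF (q + k - r) q‖) ^ 2 ≤
      ‖luneCoeff φ q‖ ^ 2 * (39936 * (g / (2 * Real.pi) ^ 3)) := fun q hq => by
    calc ∑ r ∈ lune kF k,
          (‖luneCoeff φ q‖ * ‖luneCoeff φ r‖ * ‖dressedPair (coulomb g) kF (q + k - r) q‖) ^ 2
        ≤ ∑ r ∈ lune kF k, ‖luneCoeff φ q‖ ^ 2 * (128 / (kF ^ 2 * len k) *
          (4 * kF * len k * (g / (2 * Real.pi) ^ 3))) * (normSq (q + k - r))⁻¹ := by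
          refine Finset.sum_le_sum fun r hr => ?_
          rw [mul_pow, mul_pow, mul_assoc, mul_assoc, mul_assoc]
          have h6 := hκ r
          have h7 := h1 q hq r hr
          gcongr
      _ = ‖luneCoeff φ q‖ ^ 2 * (128 / (kF ^ 2 * len k) *
          (4 * kF * len k * (g / (2 * Real.pi) ^ 3))) *
          ∑ r ∈ lune kF k, (normSq (q + k - r))⁻¹ := by rw [Finset.mul_sum]
      _ ≤ ‖luneCoeff φ q‖ ^ 2 * (128 / (kF ^ 2 * len k) *
          (4 * kF * len k * (g / (2 * Real.pi) ^ 3))) * (78 * kF) := by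
          gcongr
          exact sum_lune_inv_normSq_transfer_le hkF0.le hk hq
      _ = _ := by
          field_simp
          ring
  calc _ ≤ 64 * ∑ q ∈ lune kF k, ‖luneCoeff φ q‖ ^ 2 * (39936 * (g / (2 * Real.pi) ^ 3)) := by
        gcongr with q hq
        exact h5 q hq
    _ = _ := by
        rw [← Finset.sum_mul, sum_norm_luneCoeff_sq, hφ]
        ring

/-! ### Threshold, delocalization and error bounds -/

theorem exists_threshold {δ ε : ℝ} (hδ : δ < 1 / 2) (hε : ε < 1) (A : ℝ) :
    ∃ K : ℝ, 0 < K ∧ ∀ kF : ℝ, K ≤ kF → 2 ≤ kF ∧ A ≤ kF ^ (1 - 2 * δ) ∧ 512 ≤ kF ^ (1 - ε) := by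
  have h1 := (tendsto_rpow_atTop (by linarith : 0 < 1 - 2 * δ)).eventually_ge_atTop A
  have h2 := (tendsto_rpow_atTop (by linarith : 0 < 1 - ε)).eventually_ge_atTop 512
  obtain ⟨K, hK⟩ := Filter.eventually_atTop.mp
    ((Filter.eventually_ge_atTop (2 : ℝ)).and (h1.and h2))
  exact ⟨max K 1, by positivity, fun kF hkF => hK kF ((le_max_left _ _).trans hkF)⟩

/-- The bounds that hold above the momentum threshold. -/
theorem threshold_bounds {δ A : ℝ} (hδ0 : 0 < δ) (hδ : δ < 1 / 2) (hkF : 2 ≤ kF)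
    (hA : A ≤ kF ^ (1 - 2 * δ)) (hk : len k ≤ kF ^ δ) :
    len k ≤ kF ∧ A * len k ^ 2 ≤ kF := by
  have h0 : 0 < kF := by linarith
  refine ⟨hk.trans ?_, ?_⟩
  · calc kF ^ δ ≤ kF ^ (1 : ℝ) := Real.rpow_le_rpow_of_exponent_le (by linarith) (by linarith)
      _ = kF := Real.rpow_one kF
  · have h1 : kF ^ (1 - 2 * δ) * (kF ^ δ) ^ 2 = kF := by
      rw [← Real.rpow_natCast, ← Real.rpow_mul h0.le, ← Real.rpow_add h0]
      convert Real.rpow_one kF using 2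
      push_cast
      ring
    calc A * len k ^ 2 ≤ kF ^ (1 - 2 * δ) * (kF ^ δ) ^ 2 := by
          have := len_nonneg k
          gcongr
      _ = kF := h1

theorem le_norm_sq_wVec (hg : 0 < g) (hkF : 2 ≤ kF) (hk : k ≠ 0) :
    g / (32 * (2 * Real.pi) ^ 3) * kF ^ 3 ≤ ‖wVec kF (coulomb g) k‖ ^ 2 := by
  have hpi := Real.pi_pos
  rw [norm_sq_wVec_coulomb hg (by linarith) hk]
  calc _ = g / (4 * (2 * Real.pi) ^ 3) * (kF ^ 3 / 8) := by ring
    _ ≤ _ := by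
      gcongr
      exact le_card_fermiBall hkF

/-- The coupling cancels from `|w_p|²/‖w‖²`, leaving `λ_p / (N|k|²/2)`, estimated by `λ_p ≤ 2
k_F|k|` and `N ≥ k_F³/8`. -/
theorem norm_luneCoeff_sq_le {μ : ℝ} {φ : LuneSpace kF k} (hg : 0 < g) (hkF : 2 ≤ kF)
    (hk0 : k ≠ 0) (hk : len k ≤ kF)
    (hμ : EOp kF (coulomb g) k (EOp kF (coulomb g) k φ) = (μ : ℂ) • φ) (hφ : ‖φ‖ = 1)
    (hLμ : 2 * (2 * kF * len k) ^ 2 ≤ μ) (p : Momentum) :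
    ‖luneCoeff φ p‖ ^ 2 ≤ 128 / (kF ^ 2 * len k) := by
  have hkF0 : 0 < kF := by linarith
  have hk1 : 0 < len k := lt_of_lt_of_le one_pos (one_le_len hk0)
  have hμ0 : 0 < μ := lt_of_lt_of_le (by positivity) hLμ
  by_cases hp : p ∈ lune kF k
  · have hE := excEnergy_le hkF0.le hk hp
    have hE0 := excEnergy_pos hkF0.le hp
    have h1 := norm_eigenvector_apply_sq_le hkF0.le hμ hφ (L := (2 * kF * len k) ^ 2)
      (fun q hq => by
        have := excEnergy_pos hkF0.le hq
        gcongr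
        exact excEnergy_le hkF0.le hk hq) hLμ hμ0 ⟨p, hp⟩
    rw [norm_sq_wVec hkF0.le, wVec_apply, Complex.norm_real, Real.norm_eq_abs, sq_abs, mul_pow,
      Real.sq_sqrt hE0.le, sum_excEnergy_lune, ← len_sq] at h1
    have hc : 0 < coupling (coulomb g) k ^ 2 := by
      have := Real.pi_pos
      rw [coupling_coulomb_sq hg, ← len_sq]
      positivity
    have h2 := le_card_fermiBall hkF
    have h3 : luneCoeff φ p = φ ⟨p, hp⟩ := luneCoeff_coe φ ⟨p, hp⟩
    rw [h3]
    set z := ‖φ ⟨p, hp⟩‖ ^ 2 with hz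
    have hz0 : 0 ≤ z := sq_nonneg _
    have h4 : z * (kF ^ 3 / 8 * len k ^ 2 / 2) ≤ 4 * (2 * kF * len k) := by
      refine le_of_mul_le_mul_right ?_ hc
      calc _ = z * (coupling (coulomb g) k ^ 2 * (kF ^ 3 / 8 * len k ^ 2 / 2)) := by ring
        _ ≤ z * (coupling (coulomb g) k ^ 2 * ((fermiBall kF).card * len k ^ 2 / 2)) := by
          gcongr
        _ ≤ _ := h1
        _ ≤ 4 * (2 * kF * len k) * coupling (coulomb g) k ^ 2 := by
          rw [mul_assoc]
          gcongr
    rw [le_div_iff₀ (by positivity)]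
    have h5 : 0 < kF * len k / 16 := by positivity
    refine le_of_mul_le_mul_right ?_ h5
    calc _ = z * (kF ^ 3 / 8 * len k ^ 2 / 2) := by ring
      _ ≤ _ := h4
      _ = _ := by ring
  · rw [luneCoeff_of_notMem φ hp]
    rw [norm_zero, zero_pow two_ne_zero]
    positivity

theorem plasmon_residual_le {φ : LuneSpace kF k} {V : Momentum → ℝ} {ek κ R : ℝ} (hφ : ‖φ‖ = 1)
    (hek : ((2 : ℂ) • EOp kF V k) φ = (ek : ℂ) • φ)
    (hκ : ∀ p, ‖luneCoeff φ p‖ ^ 2 ≤ κ)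
    (hR : ‖doubleCommutator φ V (fermiState kF)‖ ≤ R) {M : ℕ} (hM1 : 1 ≤ M)
    (hM : 4 * κ * M ^ 2 ≤ 1) :
    plasmonState kF k φ M ≠ 0 ∧ plasmonState kF k φ M ∈ excitationSpace kF M ∧
    ∃ hdom : normalized (plasmonState kF k φ M) ∈ (effHamiltonian kF V).domain,
      ‖effHamiltonian kF V ⟨normalized (plasmonState kF k φ M), hdom⟩ -
          ((M * ek : ℝ) : ℂ) • normalized (plasmonState kF k φ M)‖ ≤
        R * (M : ℝ) ^ (5 / 2 : ℝ) := by
  have hφ0 : φ ≠ 0 := by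
    rw [← norm_ne_zero_iff, hφ]; exact one_ne_zero
  have hlow := norm_plasmonState_sq_ge φ hφ hκ hM
  have hfac : (0 : ℝ) < M.factorial := by exact_mod_cast M.factorial_pos
  have hΨ0 : plasmonState kF k φ M ≠ 0 := by
    intro h
    rw [h, norm_zero] at hlow
    norm_num at hlow
    linarith
  refine ⟨hΨ0, sector_le_excitationSpace kF M (plasmonState_mem_sector φ M), ?_⟩
  obtain ⟨hdom, h⟩ := norm_effHamiltonian_sub_eq φ V hφ0 hek M
  refine ⟨hdom, ?_⟩
  rw [h]
  have hR0 : 0 ≤ R := (norm_nonneg _).trans hR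
  rcases Nat.lt_or_ge M 2 with hM2 | hM2
  · have : M = 1 := by omega
    subst this
    simp [hR0]
  · have hz0 := norm_nonneg ((bCreGen kF k φ ^ (M - 2)) (doubleCommutator φ V (fermiState kF)))
    have hup := norm_bCreGen_pow_sq_le φ hφ (doubleCommutator_mem_sector φ V) (M - 2)
    rw [Nat.sub_add_cancel hM2] at hup
    have hpos : 0 < ‖plasmonState kF k φ M‖ := norm_pos_iff.mpr hΨ0
    generalize ‖plasmonState kF k φ M‖ = u at hlow hpos
    generalize ‖(bCreGen kF k φ ^ (M - 2)) (doubleCommutator φ V (fermiState kF))‖ = z at hup hz0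
    have hG0 : 0 ≤ ‖doubleCommutator φ V (fermiState kF)‖ := norm_nonneg _
    generalize ‖doubleCommutator φ V (fermiState kF)‖ = G at hup hR hG0
    -- The upper bound `M!/2` and the lower bound `M!/2` carry the same constant, so no loss occurs
    -- in the ratio.
    have h1 : z ≤ G * u := by
      refine le_of_sq_le_sq ?_ (by positivity)
      nlinarith [mul_le_mul_of_nonneg_right hlow (sq_nonneg G)]
    have h2 : (M.choose 2 : ℝ) ≤ M ^ 2 := by
      have h3 : M.choose 2 ≤ M ^ 2 := Nat.choose_le_pow M 2
      exact_mod_cast h3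
    have h4 : (M : ℝ) ^ 2 ≤ (M : ℝ) ^ (5 / 2 : ℝ) := by
      rw [← Real.rpow_natCast]
      exact Real.rpow_le_rpow_of_exponent_le (by exact_mod_cast hM1) (by norm_num)
    calc u⁻¹ * (M.choose 2 * z) ≤ u⁻¹ * (M ^ 2 * (G * u)) := by gcongr
      _ = G * M ^ 2 := by field_simp
      _ ≤ R * (M : ℝ) ^ (5 / 2 : ℝ) := by gcongr

/-- With `ε_k/2 ≥ c k_F^{3/2}`, the error is of order `k_F⁴|k|⁴ / k_F^{9/2}`; writing `k_F = s²`
avoids fractional powers. -/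
theorem div_le_of_le_eigenvalue {ek κ : ℝ} (hg : 0 < g) (hkF : 0 < kF)
    (hek : 0 < ek) (h : 2 * (g / (32 * (2 * Real.pi) ^ 3) * kF ^ 3) ≤ (ek / 2) ^ 2) :
    16 * ((2 * kF * κ) ^ 2) ^ 2 / (ek / 2) ^ 2 / ek ≤
      128 / √(g / (16 * (2 * Real.pi) ^ 3)) ^ 3 * kF ^ (-(1 / 2) : ℝ) * κ ^ 4 := by
  have hpi := Real.pi_pos
  have hd : 0 < g / (16 * (2 * Real.pi) ^ 3) := by positivity
  rw [show 2 * (g / (32 * (2 * Real.pi) ^ 3) * kF ^ 3) =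
    g / (16 * (2 * Real.pi) ^ 3) * kF ^ 3 by ring, ← Real.sq_sqrt hd.le] at h
  have hc0 := Real.sqrt_pos.mpr hd
  rw [Real.rpow_neg hkF.le, ← Real.sqrt_eq_rpow]
  have hs0 : 0 < √kF := Real.sqrt_pos.mpr hkF
  have hs : kF = √kF ^ 2 := (Real.sq_sqrt hkF.le).symm
  generalize √(g / (16 * (2 * Real.pi) ^ 3)) = c at h hc0 ⊢
  generalize √kF = s at hs hs0 ⊢
  subst hs
  have h7 : c * s ^ 3 ≤ ek / 2 := by
    refine le_of_sq_le_sq (le_trans (le_of_eq ?_) h) (by linarith)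
    ring
  calc 16 * ((2 * s ^ 2 * κ) ^ 2) ^ 2 / (ek / 2) ^ 2 / ek
      = 128 * (s ^ 8 * κ ^ 4) / (ek / 2) ^ 3 := by
        field_simp
        ring
    _ ≤ 128 * (s ^ 8 * κ ^ 4) / (c * s ^ 3) ^ 3 := by gcongr
    _ = 128 / c ^ 3 * s⁻¹ * κ ^ 4 := by field_simp

theorem abs_eigenvalue_sub_sqrt_le {ek : ℝ} {φ : LuneSpace kF k} (hg : 0 < g) (hkF : 2 ≤ kF)
    (hk0 : k ≠ 0) (hk : len k ≤ kF) (hek : 0 ≤ ek)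
    (hμ : EOp kF (coulomb g) k (EOp kF (coulomb g) k φ) = (((ek / 2) ^ 2 : ℝ) : ℂ) • φ)
    (hφ : φ ≠ 0) (hLμ : 2 * (2 * kF * len k) ^ 2 ≤ (ek / 2) ^ 2)
    (hW : 2 * ‖wVec kF (coulomb g) k‖ ^ 2 ≤ (ek / 2) ^ 2) :
    |ek - √(8 * vMoment kF (coulomb g) k 1 +
        4 * (vMoment kF (coulomb g) k 3 / vMoment kF (coulomb g) k 1))| ≤
      128 / √(g / (16 * (2 * Real.pi) ^ 3)) ^ 3 * kF ^ (-(1 / 2) : ℝ) * len k ^ 4 := by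
  have hpi := Real.pi_pos
  have hkF0 : 0 < kF := by linarith
  have hk1 : 0 < len k := lt_of_lt_of_le one_pos (one_le_len hk0)
  have hμ0 : 0 < (ek / 2) ^ 2 := lt_of_lt_of_le (by positivity) hLμ
  have hek0 : 0 < ek := by
    rcases hek.lt_or_eq with h | h
    · exact h
    · rw [← h] at hμ0; norm_num at hμ0
  have hL : ∀ p ∈ lune kF k, excEnergy k p ^ 2 ≤ (2 * kF * len k) ^ 2 := fun q hq => by
    have := excEnergy_pos hkF0.le hq
    gcongr
    exact excEnergy_le hkF0.le hk hq
  have hw : ∑ p ∈ lune kF k, coupling (coulomb g) k ^ 2 * excEnergy k p =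
      ‖wVec kF (coulomb g) k‖ ^ 2 := by rw [norm_sq_wVec hkF0.le, Finset.mul_sum]
  have hWlow := le_norm_sq_wVec hg hkF hk0
  have hWpos : 0 < ‖wVec kF (coulomb g) k‖ ^ 2 := lt_of_lt_of_le (by positivity) hWlow
  have h1 := abs_sub_le_of_secular (s := lune kF k)
    (w := fun p => coupling (coulomb g) k ^ 2 * excEnergy k p)
    (x := fun p => excEnergy k p ^ 2) (μ := (ek / 2) ^ 2) (L := (2 * kF * len k) ^ 2)
    (fun p hp => mul_nonneg (sq_nonneg _) (excEnergy_pos hkF0.le hp).le)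
    (fun p _ => sq_nonneg _) hL hLμ hμ0 (by rw [hw]; exact hWpos) (by rw [hw]; exact hW)
    (secular_equation hkF0.le hμ hφ hL hLμ hμ0)
  have h2 : vMoment kF (coulomb g) k 1 =
      ∑ p ∈ lune kF k, coupling (coulomb g) k ^ 2 * excEnergy k p := by
    rw [vMoment_eq]; simp
  have h3 : vMoment kF (coulomb g) k 3 =
      ∑ p ∈ lune kF k, coupling (coulomb g) k ^ 2 * excEnergy k p * excEnergy k p ^ 2 := by
    rw [vMoment_eq]
    exact Finset.sum_congr rfl fun p _ => by ring
  rw [← h2, ← h3, show 4 * (ek / 2) ^ 2 = ek ^ 2 by ring] at h1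
  have h4 : 0 ≤ 8 * vMoment kF (coulomb g) k 1 +
      4 * (vMoment kF (coulomb g) k 3 / vMoment kF (coulomb g) k 1) := by
    have h5 : 0 ≤ vMoment kF (coulomb g) k 1 := by rw [h2, hw]; exact hWpos.le
    have h6 : 0 ≤ vMoment kF (coulomb g) k 3 := by
      rw [h3]
      refine Finset.sum_nonneg fun p hp => ?_
      have := excEnergy_pos hkF0.le hp
      positivity
    exact add_nonneg (mul_nonneg (by norm_num) h5) (mul_nonneg (by norm_num) (div_nonneg h6 h5))
  refine (abs_sub_sqrt_le hek0 h4 h1).trans ?_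
  exact div_le_of_le_eigenvalue hg hkF0 hek0
    ((mul_le_mul_of_nonneg_left hWlow zero_le_two).trans hW)

end Coulomb

end Plasmon

/-! ### Choice of constants and conclusion -/

open Plasmon in
theorem theorem1 (δ ε : ℝ) (hδ0 : 0 < δ) (hδ : δ < 1 / 2) (hε0 : 0 < ε) (hε : ε < 1) :
    ∃ C : ℝ, 0 < C ∧ ∀ g : ℝ, 0 < g →
      ∃ C' : ℝ, 0 < C' ∧ ∃ K : ℝ, 0 < K ∧
        ∀ kF : ℝ, K ≤ kF → ∀ k : Momentum, k ≠ 0 → len k ≤ kF ^ δ →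
          ∃ ek : ℝ, IsGreatest (eigenvalues2E kF (coulomb g) k) ek ∧
            (∀ φ : LuneSpace kF k, ‖φ‖ = 1 →
              ((2 : ℂ) • EOp kF (coulomb g) k) φ = (ek : ℂ) • φ →
              ∀ M : ℕ, 1 ≤ M → (M : ℝ) ≤ kF ^ ε →
                plasmonState kF k φ M ≠ 0 ∧
                plasmonState kF k φ M ∈ excitationSpace kF M ∧
                ∃ hdom : normalized (plasmonState kF k φ M) ∈
                    (effHamiltonian kF (coulomb g)).domain,
                  ‖effHamiltonian kF (coulomb g) ⟨normalized (plasmonState kF k φ M), hdom⟩ -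
                      ((M * ek : ℝ) : ℂ) • normalized (plasmonState kF k φ M)‖ ≤
                    C * (len k)⁻¹ * Real.sqrt kF * (M : ℝ) ^ (5 / 2 : ℝ)) ∧
            |ek - Real.sqrt (8 * vMoment kF (coulomb g) k 1 +
                4 * (vMoment kF (coulomb g) k 3 / vMoment kF (coulomb g) k 1))| ≤
              C' * kF ^ (-(1 / 2) : ℝ) * len k ^ 4 := by
  have hpi := Real.pi_pos
  -- `C = 1` suffices for every `g`: the norm of the double commutator depends on `g` but not on
  -- `k_F`, and the threshold `K` absorbs it.
  refine ⟨1, one_pos, fun g hg => ⟨128 / √(g / (16 * (2 * Real.pi) ^ 3)) ^ 3, ?_, ?_⟩⟩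
  · have : 0 < √(g / (16 * (2 * Real.pi) ^ 3)) := Real.sqrt_pos.mpr (by positivity)
    positivity
  -- The first entry of the maximum secures the spectral gap `2 (2k_F|k|)² ≤ μ`; the second makes
  -- the bound on the double commutator at most `k_F |k|^{-2}`.
  obtain ⟨K, hK0, hK⟩ := exists_threshold hδ hε
    (max (128 * ((2 * Real.pi) ^ 3 / g)) (2555904 * (g / (2 * Real.pi) ^ 3)))
  refine ⟨K, hK0, fun kF hKkF k hk0 hkδ => ?_⟩
  obtain ⟨hkF, hA, hM512⟩ := hK kF hKkF
  have hkF0 : 0 < kF := by linarith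
  have hk1 : 1 ≤ len k := one_le_len hk0
  have hk1' : 0 < len k := by linarith
  obtain ⟨hk, hA1⟩ := threshold_bounds hδ0 hδ hkF ((le_max_left _ _).trans hA) hkδ
  obtain ⟨-, hA2⟩ := threshold_bounds hδ0 hδ hkF ((le_max_right _ _).trans hA) hkδ
  have hWlow := le_norm_sq_wVec hg hkF hk0
  have hw0 : wVec kF (coulomb g) k ≠ 0 := by
    intro h
    rw [h, norm_zero] at hWlow
    have : 0 < g / (32 * (2 * Real.pi) ^ 3) * kF ^ 3 := by positivity
    norm_num at hWlow
    linarith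
  have : Nontrivial (LuneSpace kF k) := ⟨⟨_, 0, hw0⟩⟩
  obtain ⟨ek, hek0, hgreat, hray⟩ := exists_isGreatest_eigenvalues2E (kF := kF) (k := k)
    (V := coulomb g)
  have hW := two_mul_norm_wVec_sq_le hkF0.le (norm_EOp_apply_le (by linarith) hray) hw0
  have hLμ : 2 * (2 * kF * len k) ^ 2 ≤ (ek / 2) ^ 2 := by
    refine le_trans ?_ hW
    refine mul_le_mul_of_nonneg_left (le_trans ?_ hWlow) zero_le_two
    have h1 : len k ^ 2 ≤ g / (128 * (2 * Real.pi) ^ 3) * kF := by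
      calc len k ^ 2 = g / (128 * (2 * Real.pi) ^ 3) *
            (128 * ((2 * Real.pi) ^ 3 / g) * len k ^ 2) := by field_simp
        _ ≤ _ := by gcongr
    calc (2 * kF * len k) ^ 2 = 4 * kF ^ 2 * len k ^ 2 := by ring
      _ ≤ 4 * kF ^ 2 * (g / (128 * (2 * Real.pi) ^ 3) * kF) := by gcongr
      _ = _ := by ring
  have hsq : ∀ φ : LuneSpace kF k, ((2 : ℂ) • EOp kF (coulomb g) k) φ = (ek : ℂ) • φ →
      EOp kF (coulomb g) k (EOp kF (coulomb g) k φ) = (((ek / 2) ^ 2 : ℝ) : ℂ) • φ := by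
    intro φ hφ
    have h1 : EOp kF (coulomb g) k φ = ((ek / 2 : ℝ) : ℂ) • φ := by
      have h2 : EOp kF (coulomb g) k φ =
          (2⁻¹ : ℂ) • ((2 : ℂ) • EOp kF (coulomb g) k) φ := by
        rw [smul_apply, smul_smul]; simp
      rw [h2, hφ, smul_smul]
      congr 1
      push_cast
      ring
    rw [h1, map_smul, h1, smul_smul, sq]
    push_cast
    rfl
  refine ⟨ek, hgreat, fun φ hφ hek M hM1 hMε => ?_, ?_⟩
  · have hκ := norm_luneCoeff_sq_le hg hkF hk0 hk (hsq φ hek) hφ hLμ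
    have hR : ‖doubleCommutator φ (coulomb g) (fermiState kF)‖ ≤
        1 * (len k)⁻¹ * Real.sqrt kF := by
      refine le_of_sq_le_sq ?_ (by positivity)
      refine (norm_doubleCommutator_coulomb_sq_le hg hkF hk0 hk hφ hκ).trans ?_
      rw [one_mul, mul_pow (len k)⁻¹, Real.sq_sqrt hkF0.le, inv_pow, inv_mul_eq_div,
        le_div_iff₀ (by positivity)]
      exact hA2
    refine plasmon_residual_le hφ hek hκ hR hM1 ?_
    -- Together with `κ = 128/(k_F²|k|)`, this gives the smallness condition `4 κ M² ≤ 1`.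
    have h1 : 512 * (M : ℝ) ≤ kF := by
      calc 512 * (M : ℝ) ≤ kF ^ (1 - ε) * kF ^ ε := by gcongr
        _ = kF := by rw [← Real.rpow_add hkF0]; simp
    have h2 : 512 * (M : ℝ) ^ 2 ≤ kF ^ 2 * len k := by
      have h3 : (0 : ℝ) ≤ M := M.cast_nonneg
      have h4 : (512 * (M : ℝ)) ^ 2 ≤ kF ^ 2 := by gcongr
      nlinarith [sq_nonneg (M : ℝ), sq_nonneg kF]
    rw [show 4 * (128 / (kF ^ 2 * len k)) * (M : ℝ) ^ 2 =
      512 * (M : ℝ) ^ 2 / (kF ^ 2 * len k) by ring]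
    exact div_le_one_of_le₀ h2 (by positivity)
  · obtain ⟨φ, hφ⟩ := Module.End.HasEigenvalue.exists_hasEigenvector hgreat.1
    exact abs_eigenvalue_sub_sqrt_le hg hkF hk0 hk hek0 (hsq φ hφ.apply_eq_smul) hφ.2 hLμ hW
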